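/- Let $d\ge 1$, let $\|\cdot\|_B$ be an arbitrary norm on $\mathbb R^d$ with closed unit ball $B$, and let $\lambda$ denote Lebesgue measure on $\mathbb R^d$. For a set $D\subset\mathbb R^d$ put $$F^B(D)=\{f\colon D\to\mathbb R \;:\; |f(x)-f(y)|\le\|x-y\|_B \text{ for all } x,y\in D\},$$ and let $$e_n(D)=\inf_{A_n}\ \sup_{f\in F^B(D)}\ \sup_{x\in D}|f(x)-A_n(f)(x)|,$$ where the infimum is over all algorithms $A_n$ that use $n$ function values, i.e. $A_n(f)=\varphi(f(x_1),\dots,f(x_n))$ with an arbitrary map $\varphi$ from $\mathbb R^n$ to the real functions on $D$ and with points $x_i\in D$, where $x_i$ may depend on $f(x_1),\dots,f(x_{i-1})$. Let $\Theta_B$ be the covering constant of $\mathbb R^d$ with respect to $B$, i.e. the infimum, over all $X\subset\mathbb R^d$ with $X+B=\mathbb R^d$, of the densities $$\liminf_{R\to\infty}\frac{\#(X\cap[-R,R]^d)\,\lambda(B)}{(2R)^d}.$$ Let $\mathcal D_d$ be the family of all bounded Jordan measurable sets $D\subset\mathbb R^d$ (i.e. bounded sets with $\lambda(\partial D)=0$)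 that have an interior point. Then: 1. For every $D\in\mathcal D_d$, $$\lim_{n\to\infty}\frac{e_n(D)}{\Theta_B^{1/d}\left(\lambda(D)/\lambda(B)\right)^{1/d}n^{-1/d}}=1 .$$ 2. $1\le\Theta_B$, and if $d\ge2$ then $\Theta_B\le d\log d+d\log\log d+5d$. 3. For every integer $n\ge1$, $$\inf_{D\in\mathcal D_d} e_n(D)\,\lambda(D)^{-1/d}=\lambda(B)^{-1/d}\,n^{-1/d},$$ and the infimum is attained: every union of $n$ pairwise disjoint closed $\|\cdot\|_B$-balls of the same radius $r>0$ belongs to $\mathcal D_d$ and gives equality. -/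

import Mathlib

open MeasureTheory Filter Topology
open scoped ENNReal

namespace LipApprox

/-- `D` is a bounded Jordan measurable subset of `ℝ^d`: it is bounded and its topological
boundary is a Lebesgue null set. -/
def IsJordanMeasurable {d : ℕ} (D : Set (Fin d → ℝ)) : Prop :=
  Bornology.IsBounded D ∧ volume (frontier D) = 0

/-- The domains under consideration: bounded Jordan measurable sets with an interior point. -/
def domains (d : ℕ) : Set (Set (Fin d → ℝ)) :=
  {D | IsJordanMeasurable D ∧ (interior D).Nonempty}

/-- The closed unit ball of the norm `p`. -/
def unitBall {d : ℕ} (p : Seminorm ℝ (Fin d → ℝ)) : Set (Fin d → ℝ) :=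
  p.closedBall 0 1

/-- All `f : D → ℝ` with `|f x - f y| ≤ p (x - y)`. -/
def lipClass {d : ℕ} (p : Seminorm ℝ (Fin d → ℝ)) (D : Set (Fin d → ℝ)) : Set (D → ℝ) :=
  {f | ∀ x y : D, |f x - f y| ≤ p ((x : Fin d → ℝ) - y)}

/-- A (deterministic, possibly adaptive) algorithm for the approximation of functions on `D` from
function values: `next l` is the point at which the function is evaluated after the values in the
list `l` have been observed, and `output l` is the approximation that is returned when `l` is
the list of all the observed values. -/
structure Algorithm {d : ℕ} (D : Set (Fin d → ℝ)) where
  /-- the next sample point -/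
  next : List ℝ → D
  /-- the approximation that is returned -/
  output : List ℝ → D → ℝ

/-- The list of the first `n` function values of `f` that the algorithm observes. -/
def Algorithm.data {d : ℕ} {D : Set (Fin d → ℝ)} (A : Algorithm D) (f : D → ℝ) : ℕ → List ℝ
  | 0 => []
  | n + 1 => A.data f n ++ [f (A.next (A.data f n))]

/-- The worst case error, in the sup norm on `D`, of the algorithm `A` stopped after `n` function
values. -/
noncomputable def worstError {d : ℕ} (p : Seminorm ℝ (Fin d → ℝ)) {D : Set (Fin d → ℝ)}
    (A : Algorithm D) (n : ℕ) : ℝ≥0∞ :=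
  ⨆ f ∈ lipClass p D, ⨆ x : D, ENNReal.ofReal |f x - A.output (A.data f n) x|

/-- The `n`-th minimal worst case error of `L_∞`-approximation on the Lipschitz class, over all
algorithms that use `n` function values. -/
noncomputable def minError {d : ℕ} (p : Seminorm ℝ (Fin d → ℝ)) (D : Set (Fin d → ℝ))
    (n : ℕ) : ℝ≥0∞ :=
  ⨅ A : Algorithm D, worstError p A n

/-- The translates `x + B`, `x ∈ X`, of the unit ball of `p` cover the space. -/
def IsCovering {d : ℕ} (p : Seminorm ℝ (Fin d → ℝ)) (X : Set (Fin d → ℝ)) : Prop :=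
  ∀ y, ∃ x ∈ X, y - x ∈ unitBall p

/-- The cube `[-R, R]^d`. -/
def cube (d : ℕ) (R : ℝ) : Set (Fin d → ℝ) :=
  Set.Icc (fun _ => -R) (fun _ => R)

/-- The (lower) density of the system of translates `x + B`, `x ∈ X`, of the unit ball of `p`:
the total volume of the translates centred in `[-R, R]^d`, relative to the volume of this cube,
as `R → ∞`. -/
noncomputable def density {d : ℕ} (p : Seminorm ℝ (Fin d → ℝ)) (X : Set (Fin d → ℝ)) : ℝ≥0∞ :=
  liminf (fun R : ℝ =>
    ((X ∩ cube d R).encard : ℝ≥0∞) * volume (unitBall p) / volume (cube d R)) atTop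

/-- The covering constant `Θ_B`: the infimum of the densities of all coverings of `ℝ^d` by
translates of the unit ball `B` of `p`. -/
noncomputable def coveringConstant {d : ℕ} (p : Seminorm ℝ (Fin d → ℝ)) : ℝ≥0∞ :=
  ⨅ X : {X : Set (Fin d → ℝ) // IsCovering p X}, density p X.1

end LipApprox

/-!
The problem reduces to coverings. For the zero function an algorithm uses nodes `x₁, …, xₙ`; the
distance function of these nodes and its negative give the same data, hence one of them is
approximated no better than the covering radius of the nodes, while nearest neighbour interpolation
attains this radius (`exists_covers_of_minError_lt`, `minError_le_of_covers`). So the minimal error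
is, up to arbitrarily small changes, the least radius for which `n` balls with centres in `D`
cover `D`.

*Asymptotics.* Let `N δ` be the number of balls of radius `δ` needed to cover `D`, and let `θ` be the
covering constant. Periodic repetition of a covering of a cube gives a covering of the space, so
`θ` is a lower bound for the density of any covering of a cube (`coveringConstant_mul_le`), and it is
approached by coverings of large cubes (`exists_covers_cube_lt`). Filling the cells of a fine grid
with scaled copies of such a covering shows that `N δ * λ(B) * δ ^ d` is asymptotically at most
`θ * λ(closure D)`, for any bounded set (`eventually_exists_covers`). When the boundary is null, the
centres can be moved into `D`, because only a thin layer near the boundary is affected. For the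
lower bound, the upper bound is applied to `Q \ D`, where `Q` is a cube containing `D`: a sparse
covering of `D` would complete to a covering of `Q` of density less than `θ`. No decomposition of `D`
into cubes is needed for this half.

*Rogers' bound.* By averaging over the centre, `N` balls can be placed greedily so that at most the
fraction `exp (-s)` of a cube remains uncovered, where `s` is the density of the balls. A maximal
packing of balls of radius `η` in the uncovered part has density at most `exp (-s)`, that is,
`exp (-s) / η ^ d` once these balls are enlarged to radius `1`. The balls of radius `1 + η` around
all the centres cover. With `s = d * log (1 / η)` and
`η = 1 / (d * log d)` the total density is below the asserted bound.

*Sharp domains.* Comparing volumes gives the lower bound for the error on every domain, and the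
centres of `n` disjoint balls of radius `r` are nodes with covering radius `r`.
-/

namespace LipApprox

/-! ### Balls of a norm on `ℝ^d`, coverings and packings -/

theorem exists_le_mul_norm {d : ℕ} (p : Seminorm ℝ (Fin d → ℝ)) :
    ∃ b : ℝ, 0 < b ∧ ∀ x, p x ≤ b * ‖x‖ := by
  refine ⟨(∑ i, p (Pi.single i 1)) + 1, ?_, fun x => ?_⟩
  · have : 0 ≤ ∑ i, p (Pi.single i (1 : ℝ)) := Finset.sum_nonneg fun i _ => apply_nonneg p _
    linarith
  · have h1 : x = ∑ i, x i • (Pi.single i (1 : ℝ) : Fin d → ℝ) := by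
      ext j
      simp [Finset.sum_apply, Pi.single_apply]
    have h2 : p x ≤ ∑ i, p (x i • (Pi.single i (1 : ℝ) : Fin d → ℝ)) := by
      conv_lhs => rw [h1]
      exact Finset.le_sum_of_subadditive p (map_zero p).le (map_add_le_add p) _ _
    have h3 : ∑ i, p (x i • (Pi.single i (1 : ℝ) : Fin d → ℝ))
        ≤ ∑ i, ‖x‖ * p (Pi.single i (1 : ℝ)) := by
      refine Finset.sum_le_sum fun i _ => ?_
      rw [map_smul_eq_mul]
      exact mul_le_mul_of_nonneg_right (norm_le_pi_norm x i) (apply_nonneg p _)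
    rw [← Finset.mul_sum] at h3
    nlinarith [norm_nonneg x]

theorem continuous_seminorm {d : ℕ} (p : Seminorm ℝ (Fin d → ℝ)) : Continuous p := by
  obtain ⟨b, hb, h⟩ := exists_le_mul_norm p
  refine (LipschitzWith.of_dist_le_mul (K := ⟨b, hb.le⟩) fun x y => ?_).continuous
  rw [Real.dist_eq, dist_eq_norm]
  exact (abs_sub_map_le_sub p x y).trans (h _)

theorem exists_norm_le_mul {d : ℕ} (p : Seminorm ℝ (Fin d → ℝ)) (hp : ∀ x, p x = 0 → x = 0) :
    ∃ a : ℝ, 0 < a ∧ ∀ x, ‖x‖ ≤ a * p x := by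
  rcases (Metric.sphere (0 : Fin d → ℝ) 1).eq_empty_or_nonempty with he | hne
  · refine ⟨1, one_pos, fun x => ?_⟩
    by_cases hx : x = 0
    · simp [hx]
    · exfalso
      have : (‖x‖⁻¹ • x) ∈ Metric.sphere (0 : Fin d → ℝ) 1 := by
        simp [norm_smul, norm_ne_zero_iff.2 hx]
      rw [he] at this
      exact this
  · obtain ⟨z, hz, hmin⟩ := (isCompact_sphere (0 : Fin d → ℝ) 1).exists_isMinOn hne
      (continuous_seminorm p).continuousOn
    have hz1 : ‖z‖ = 1 := by simpa using hz
    have hpz : 0 < p z := by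
      refine lt_of_le_of_ne (apply_nonneg p z) fun h => ?_
      rw [hp z h.symm] at hz1
      simp at hz1
    refine ⟨(p z)⁻¹, inv_pos.2 hpz, fun x => ?_⟩
    by_cases hx : x = 0
    · simp [hx]
    have hn : 0 < ‖x‖ := norm_pos_iff.2 hx
    have h1 : (‖x‖⁻¹ • x) ∈ Metric.sphere (0 : Fin d → ℝ) 1 := by
      simp [norm_smul, hn.ne']
    have h2 : p z ≤ p (‖x‖⁻¹ • x) := hmin h1
    rw [map_smul_eq_mul, Real.norm_of_nonneg (inv_nonneg.2 hn.le)] at h2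
    rw [inv_mul_eq_div, le_div_iff₀ hpz]
    calc ‖x‖ * p z ≤ ‖x‖ * (‖x‖⁻¹ * p x) := by gcongr
      _ = p x := by field_simp

theorem isClosed_closedBall {d : ℕ} (p : Seminorm ℝ (Fin d → ℝ)) (x : Fin d → ℝ) (r : ℝ) :
    IsClosed (p.closedBall x r) :=
  isClosed_le ((continuous_seminorm p).comp (continuous_id.sub continuous_const)) continuous_const

theorem isBounded_closedBall {d : ℕ} {p : Seminorm ℝ (Fin d → ℝ)} (hp : ∀ x, p x = 0 → x = 0)
    (x : Fin d → ℝ) (r : ℝ) : Bornology.IsBounded (p.closedBall x r) := by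
  obtain ⟨a, ha, h⟩ := exists_norm_le_mul p hp
  refine (Metric.isBounded_closedBall (x := x) (r := a * r)).subset fun y hy => ?_
  rw [Metric.mem_closedBall, dist_eq_norm]
  exact (h _).trans (mul_le_mul_of_nonneg_left hy ha.le)

theorem closedBall_mem_nhds {d : ℕ} (p : Seminorm ℝ (Fin d → ℝ)) (x : Fin d → ℝ) {r : ℝ}
    (hr : 0 < r) : p.closedBall x r ∈ 𝓝 x := by
  have h : Continuous fun y => p (y - x) :=
    (continuous_seminorm p).comp (continuous_id.sub continuous_const)
  exact (h.tendsto x).eventually (ge_mem_nhds (by simpa using hr))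

/-- The volume of the closed unit ball, as a real number. -/
noncomputable def ballVol {d : ℕ} (p : Seminorm ℝ (Fin d → ℝ)) : ℝ :=
  volume.real (unitBall p)

theorem volume_unitBall {d : ℕ} {p : Seminorm ℝ (Fin d → ℝ)} (hp : ∀ x, p x = 0 → x = 0) :
    volume (unitBall p) = ENNReal.ofReal (ballVol p) :=
  (ENNReal.ofReal_toReal (isBounded_closedBall hp 0 1).measure_lt_top.ne).symm

theorem ballVol_pos {d : ℕ} {p : Seminorm ℝ (Fin d → ℝ)} (hp : ∀ x, p x = 0 → x = 0) :
    0 < ballVol p := by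
  refine ENNReal.toReal_pos ?_ (isBounded_closedBall hp 0 1).measure_lt_top.ne
  exact (Measure.measure_pos_of_mem_nhds volume (closedBall_mem_nhds p 0 one_pos)).ne'

open scoped Pointwise in
theorem volume_closedBall {d : ℕ} {p : Seminorm ℝ (Fin d → ℝ)} (hp : ∀ x, p x = 0 → x = 0)
    (x : Fin d → ℝ) {r : ℝ} (hr : 0 < r) :
    volume (p.closedBall x r) = ENNReal.ofReal (r ^ d * ballVol p) := by
  have h : p.closedBall x r = (fun y => y + -x) ⁻¹' (r • unitBall p) := by
    ext y
    rw [Set.mem_preimage, Set.mem_smul_set_iff_inv_smul_mem₀ hr.ne', unitBall,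
      Seminorm.mem_closedBall_zero, Seminorm.mem_closedBall, map_smul_eq_mul,
      Real.norm_of_nonneg (inv_nonneg.2 hr.le), inv_mul_le_iff₀ hr, mul_one, sub_eq_add_neg]
  rw [h, measure_preimage_add_right, Measure.addHaar_smul, volume_unitBall hp,
    ← ENNReal.ofReal_mul (abs_nonneg _), abs_of_nonneg (by positivity)]
  simp

/-- `Covers p F r S`: the closed `p`-balls of radius `r` centred at the points of the finite
set `F` cover `S`. -/
def Covers {d : ℕ} (p : Seminorm ℝ (Fin d → ℝ)) (F : Finset (Fin d → ℝ)) (r : ℝ)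
    (S : Set (Fin d → ℝ)) : Prop :=
  ∀ y ∈ S, ∃ x ∈ F, p (y - x) ≤ r

theorem Covers.mono {d : ℕ} {p : Seminorm ℝ (Fin d → ℝ)} {F G : Finset (Fin d → ℝ)} {r s : ℝ}
    {S T : Set (Fin d → ℝ)} (h : Covers p F r S) (hF : F ⊆ G) (hr : r ≤ s) (hS : T ⊆ S) :
    Covers p G s T := fun y hy =>
  let ⟨x, hx, hxy⟩ := h y (hS hy)
  ⟨x, hF hx, hxy.trans hr⟩

theorem Covers.union {d : ℕ} {p : Seminorm ℝ (Fin d → ℝ)} {F G : Finset (Fin d → ℝ)} {r : ℝ}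
    {S T : Set (Fin d → ℝ)} (hF : Covers p F r S) (hG : Covers p G r T) :
    Covers p (F ∪ G) r (S ∪ T) := by
  rintro y (hy | hy)
  · obtain ⟨x, hx, h⟩ := hF y hy
    exact ⟨x, Finset.mem_union_left _ hx, h⟩
  · obtain ⟨x, hx, h⟩ := hG y hy
    exact ⟨x, Finset.mem_union_right _ hx, h⟩

theorem Covers.volume_le {d : ℕ} {p : Seminorm ℝ (Fin d → ℝ)} (hp : ∀ x, p x = 0 → x = 0)
    {F : Finset (Fin d → ℝ)} {r : ℝ} (hr : 0 < r) {S : Set (Fin d → ℝ)} (h : Covers p F r S) :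
    volume S ≤ ENNReal.ofReal (F.card * (r ^ d * ballVol p)) := by
  calc volume S ≤ volume (⋃ x ∈ F, p.closedBall x r) := by
        refine measure_mono fun y hy => ?_
        obtain ⟨x, hx, hxy⟩ := h y hy
        exact Set.mem_biUnion hx hxy
    _ ≤ ∑ x ∈ F, volume (p.closedBall x r) := measure_biUnion_finset_le _ _
    _ = ENNReal.ofReal (F.card * (r ^ d * ballVol p)) := by
        simp only [volume_closedBall hp _ hr, Finset.sum_const, nsmul_eq_mul]
        rw [ENNReal.ofReal_mul (Nat.cast_nonneg _), ENNReal.ofReal_natCast]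

/-- A maximal family of pairwise disjoint balls of radius `r` inside `W` with centres in `S` turns
into a covering of `S` when the radius is doubled. -/
theorem exists_covers_of_packing {d : ℕ} {p : Seminorm ℝ (Fin d → ℝ)}
    (hp : ∀ x, p x = 0 → x = 0) {S W : Set (Fin d → ℝ)} {r : ℝ} (hr : 0 < r)
    (hW : volume W ≠ ∞) (hSW : ∀ x ∈ S, p.closedBall x r ⊆ W) :
    ∃ F : Finset (Fin d → ℝ), ↑F ⊆ S ∧ Covers p F (2 * r) S ∧
      F.card * (r ^ d * ballVol p) ≤ volume.real W := by
  classical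
  have hβ := ballVol_pos hp
  let P : Finset (Fin d → ℝ) → Prop := fun F =>
    ↑F ⊆ S ∧ (F : Set (Fin d → ℝ)).PairwiseDisjoint fun x => p.closedBall x r
  have hcard : ∀ F, P F → F.card * (r ^ d * ballVol p) ≤ volume.real W := by
    rintro F ⟨hFS, hF⟩
    have h1 : volume (⋃ x ∈ F, p.closedBall x r) = ∑ x ∈ F, volume (p.closedBall x r) :=
      measure_biUnion_finset hF fun x _ => (isClosed_closedBall p x r).measurableSet
    have h2 : volume (⋃ x ∈ F, p.closedBall x r) ≤ volume W :=
      measure_mono (Set.iUnion₂_subset fun x hx => hSW x (hFS hx))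
    simp only [h1, volume_closedBall hp _ hr, Finset.sum_const, nsmul_eq_mul] at h2
    rw [← ENNReal.ofReal_natCast, ← ENNReal.ofReal_mul (by positivity)] at h2
    exact (ENNReal.ofReal_le_iff_le_toReal hW).1 h2
  have hex : ∃ m, ∃ F, P F ∧ F.card = m := ⟨0, ∅, by simp [P]⟩
  have hbd : ∀ m, (∃ F, P F ∧ F.card = m) → m ≤ ⌊volume.real W / (r ^ d * ballVol p)⌋₊ := by
    rintro m ⟨F, hF, rfl⟩
    exact Nat.le_floor ((le_div_iff₀ (by positivity)).2 (hcard F hF))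
  obtain ⟨F, hF, hFm⟩ := Nat.findGreatest_spec (P := fun m => ∃ F, P F ∧ F.card = m)
    (hbd _ hex.choose_spec) hex.choose_spec
  refine ⟨F, hF.1, fun y hy => ?_, hcard F hF⟩
  by_contra! hfar
  have hyF : y ∉ F := fun h => by
    have := hfar y h
    simp only [sub_self, map_zero] at this
    linarith
  have hP : P (insert y F) := by
    refine ⟨?_, ?_⟩
    · rw [Finset.coe_insert]
      exact Set.insert_subset hy hF.1
    · rw [Finset.coe_insert]
      refine hF.2.insert fun x hx _ => Set.disjoint_left.2 fun z hzy hzx => ?_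
      have h1 := hfar x hx
      have h2 : p (y - x) ≤ p (z - y) + p (z - x) := by
        have := map_sub_le_add p (z - x) (z - y)
        rw [sub_sub_sub_cancel_left] at this
        linarith
      rw [Seminorm.mem_closedBall] at hzy hzx
      linarith
  have h1 := Nat.le_findGreatest (P := fun m => ∃ F, P F ∧ F.card = m)
    (hbd _ ⟨_, hP, rfl⟩) ⟨_, hP, rfl⟩
  rw [← hFm, Finset.card_insert_of_notMem hyF] at h1
  omega

/-! ### Minimal errors and covering radii -/

/-- Returning, at each point, the value at the nearest node shows that the error is at most the
covering radius of the nodes. -/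
theorem minError_le_of_covers {d : ℕ} {p : Seminorm ℝ (Fin d → ℝ)} {D : Set (Fin d → ℝ)}
    (hD : D.Nonempty) {F : Finset (Fin d → ℝ)} (hF : ↑F ⊆ D) {n : ℕ} (hn : F.card ≤ n) {r : ℝ}
    (h : Covers p F r D) : minError p D n ≤ ENNReal.ofReal r := by
  classical
  obtain ⟨z, hz⟩ := hD
  let g : ℕ → D := fun k =>
    if hk : k < F.card then ⟨F.equivFin.symm ⟨k, hk⟩, hF (F.equivFin.symm ⟨k, hk⟩).2⟩ else ⟨z, hz⟩
  have hg : ∀ x : D, ∃ k < n, p ((x : Fin d → ℝ) - g k) ≤ r := by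
    intro x
    obtain ⟨y, hy, hxy⟩ := h x x.2
    refine ⟨F.equivFin ⟨y, hy⟩, (F.equivFin ⟨y, hy⟩).2.trans_le hn, ?_⟩
    have : (g (F.equivFin ⟨y, hy⟩) : Fin d → ℝ) = y := by simp [g]
    rwa [this]
  choose k hkn hk using hg
  let A : Algorithm D := ⟨fun l => g l.length, fun l x => l.getD (k x) 0⟩
  have hdata : ∀ (f : D → ℝ) m, A.data f m = (List.range m).map fun i => f (g i) := by
    intro f m
    induction m with
    | zero => rfl
    | succ m ih =>
      rw [Algorithm.data, ih, List.range_succ, List.map_append]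
      simp [A]
  refine (iInf_le _ A).trans (iSup₂_le fun f hf => iSup_le fun x => ?_)
  refine ENNReal.ofReal_le_ofReal ?_
  have : A.output (A.data f n) x = f (g (k x)) := by
    rw [hdata]
    simp [A, hkn x]
  rw [this]
  exact (hf _ _).trans (hk x)

/-- The distance function `f` of the set of nodes used for the zero function, and its negative,
produce the same data as the zero function, so that no output is closer than `sup f` to both. -/
theorem exists_covers_of_minError_lt {d : ℕ} {p : Seminorm ℝ (Fin d → ℝ)} {D : Set (Fin d → ℝ)}
    {n : ℕ} (hn : 1 ≤ n) {r : ℝ} (h : minError p D n < ENNReal.ofReal r) :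
    ∃ F : Finset (Fin d → ℝ), ↑F ⊆ D ∧ F.card ≤ n ∧ Covers p F r D := by
  classical
  obtain ⟨A, hA⟩ := iInf_lt_iff.1 h
  have hr : 0 < r := ENNReal.ofReal_pos.1 (pos_of_gt hA)
  let x : ℕ → D := fun k => A.next (A.data (fun _ => 0) k)
  let F : Finset (Fin d → ℝ) := (Finset.range n).image fun k => (x k : Fin d → ℝ)
  have hxF : ∀ k < n, (x k : Fin d → ℝ) ∈ F := fun k hk =>
    Finset.mem_image_of_mem _ (Finset.mem_range.2 hk)
  have hne : F.Nonempty := ⟨_, hxF 0 hn⟩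
  let f : D → ℝ := fun y => F.inf' hne fun c => p ((y : Fin d → ℝ) - c)
  have hf0 : ∀ k < n, f (x k) = 0 := by
    intro k hk
    refine le_antisymm ?_ (Finset.le_inf' _ _ fun _ _ => apply_nonneg p _)
    exact (Finset.inf'_le _ (hxF k hk)).trans (by simp)
  have hlip : ∀ y z : D, f y ≤ f z + p ((y : Fin d → ℝ) - z) := by
    intro y z
    obtain ⟨c, hc, hcz⟩ := Finset.exists_mem_eq_inf' hne fun c => p ((z : Fin d → ℝ) - c)
    have h1 : f y ≤ p ((y : Fin d → ℝ) - c) := Finset.inf'_le _ hc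
    have h2 : f z = p ((z : Fin d → ℝ) - c) := hcz
    have h3 := map_add_le_add p ((y : Fin d → ℝ) - z) (z - c)
    rw [sub_add_sub_cancel] at h3
    linarith
  have hlip' : ∀ y z : D, |f y - f z| ≤ p ((y : Fin d → ℝ) - z) := by
    intro y z
    have h1 := hlip y z
    have h2 := hlip z y
    rw [map_sub_rev] at h2
    exact abs_sub_le_iff.2 ⟨by linarith, by linarith⟩
  have hmem : f ∈ lipClass p D := hlip'
  have hmem' : (fun y => -f y) ∈ lipClass p D := fun y z => by
    show |-f y - -f z| ≤ _
    rw [← neg_sub', abs_neg]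
    exact hlip' y z
  have hdata : ∀ g : D → ℝ, (∀ k < n, g (x k) = 0) →
      ∀ m ≤ n, A.data g m = A.data (fun _ => 0) m := by
    intro g hg m
    induction m with
    | zero => exact fun _ => rfl
    | succ m ih =>
      intro hm
      rw [Algorithm.data, Algorithm.data, ih (by omega)]
      congr 2
      exact hg m (by omega)
  have herr : ∀ g ∈ lipClass p D, (∀ k < n, g (x k) = 0) →
      ∀ y, |g y - A.output (A.data (fun _ => 0) n) y| < r := by
    intro g hg hg0 y
    have h1 : ENNReal.ofReal |g y - A.output (A.data g n) y| ≤ worstError p A n :=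
      le_iSup₂_of_le g hg (le_iSup (fun y => ENNReal.ofReal |g y - A.output (A.data g n) y|) y)
    rw [hdata g hg0 n le_rfl] at h1
    exact (ENNReal.ofReal_lt_ofReal_iff hr).1 (h1.trans_lt hA)
  refine ⟨F, ?_, Finset.card_image_le.trans (by simp), fun y hy => ?_⟩
  · intro y hy
    obtain ⟨k, _, rfl⟩ := Finset.mem_image.1 (Finset.mem_coe.1 hy)
    exact (x k).2
  · have h1 := abs_lt.1 (herr f hmem hf0 ⟨y, hy⟩)
    have h2 := abs_lt.1 (herr _ hmem' (fun k hk => by simp [hf0 k hk]) ⟨y, hy⟩)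
    obtain ⟨c, hc, hcy⟩ := Finset.exists_mem_eq_inf' hne fun c => p (y - c)
    refine ⟨c, hc, ?_⟩
    have h3 : f ⟨y, hy⟩ = p (y - c) := hcy
    linarith [h1.2, h2.1]

/-! ### The covering constant and coverings of cubes -/

theorem mem_cube {d : ℕ} {R : ℝ} {x : Fin d → ℝ} : x ∈ cube d R ↔ ∀ i, -R ≤ x i ∧ x i ≤ R := by
  simp only [cube, Set.mem_Icc, Pi.le_def, forall_and]

theorem volume_cube (d : ℕ) {R : ℝ} (hR : 0 ≤ R) :
    volume (cube d R) = ENNReal.ofReal ((2 * R) ^ d) := by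
  rw [cube, Real.volume_Icc_pi, ENNReal.ofReal_pow (by positivity)]
  simp [two_mul]

/-- The number of points of a translate of the lattice `2 * ρ * ℤ^d` in a cube. -/
theorem encard_lattice_le {d : ℕ} {ρ R : ℝ} (hρ : 0 < ρ) (hR : 0 ≤ R) (c : Fin d → ℝ) :
    {z : Fin d → ℤ | (fun i => c i + 2 * ρ * z i) ∈ cube d R}.encard
      ≤ (⌊(R / ρ + 1) ^ d⌋₊ : ℕ) := by
  classical
  let T : Finset (Fin d → ℤ) :=
    Fintype.piFinset fun i => Finset.Icc ⌈(-R - c i) / (2 * ρ)⌉ ⌊(R - c i) / (2 * ρ)⌋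
  have hsub : {z : Fin d → ℤ | (fun i => c i + 2 * ρ * z i) ∈ cube d R} ⊆ T := by
    intro z hz
    rw [Finset.mem_coe, Fintype.mem_piFinset]
    intro i
    have := mem_cube.1 hz i
    rw [Finset.mem_Icc, Int.ceil_le, Int.le_floor, div_le_iff₀ (by positivity),
      le_div_iff₀ (by positivity)]
    constructor <;> nlinarith
  refine (Set.encard_le_encard hsub).trans ?_
  rw [Set.encard_coe_eq_coe_finsetCard]
  norm_cast
  refine Nat.le_floor ?_
  rw [Fintype.card_piFinset, Nat.cast_prod]
  calc ∏ i, ((Finset.Icc ⌈(-R - c i) / (2 * ρ)⌉ ⌊(R - c i) / (2 * ρ)⌋).card : ℝ)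
      ≤ ∏ _i : Fin d, (R / ρ + 1) := by
        refine Finset.prod_le_prod (fun _ _ => Nat.cast_nonneg _) fun i _ => ?_
        rw [Int.card_Icc]
        have h1 := Int.le_ceil ((-R - c i) / (2 * ρ))
        have h2 := Int.floor_le ((R - c i) / (2 * ρ))
        have h3 : (R - c i) / (2 * ρ) - (-R - c i) / (2 * ρ) = R / ρ := by
          field_simp
          ring
        have h4 : 0 ≤ R / ρ := by positivity
        have h5 : ((⌊(R - c i) / (2 * ρ)⌋ + 1 - ⌈(-R - c i) / (2 * ρ)⌉ : ℤ) : ℝ) ≤ R / ρ + 1 := by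
          push_cast
          linarith
        rcases le_total 0 (⌊(R - c i) / (2 * ρ)⌋ + 1 - ⌈(-R - c i) / (2 * ρ)⌉) with h | h
        · have : (((⌊(R - c i) / (2 * ρ)⌋ + 1 - ⌈(-R - c i) / (2 * ρ)⌉).toNat : ℤ) : ℝ)
              ≤ R / ρ + 1 := by rwa [Int.toNat_of_nonneg h]
          exact_mod_cast this
        · rw [Int.toNat_of_nonpos h]
          push_cast
          linarith
    _ = (R / ρ + 1) ^ d := by simp

/-- Repeating a covering of a cube periodically yields a covering of the whole space. -/
theorem coveringConstant_le_of_covers {d : ℕ} {p : Seminorm ℝ (Fin d → ℝ)}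
    (hp : ∀ x, p x = 0 → x = 0) {F : Finset (Fin d → ℝ)} {ρ : ℝ} (hρ : 0 < ρ)
    (h : Covers p F 1 (cube d ρ)) :
    coveringConstant p ≤ ENNReal.ofReal (F.card * ballVol p / (2 * ρ) ^ d) := by
  classical
  have hβ := ballVol_pos hp
  let φ : (Fin d → ℝ) → (Fin d → ℤ) → Fin d → ℝ := fun c z i => c i + 2 * ρ * z i
  let X : Set (Fin d → ℝ) := ⋃ c ∈ F, Set.range (φ c)
  have hX : IsCovering p X := by
    intro y
    let z : Fin d → ℤ := fun i => ⌊(y i + ρ) / (2 * ρ)⌋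
    obtain ⟨c, hc, hyc⟩ := h (fun i => y i - 2 * ρ * z i) (mem_cube.2 fun i => by
      have h1 := Int.floor_le ((y i + ρ) / (2 * ρ))
      have h2 := Int.lt_floor_add_one ((y i + ρ) / (2 * ρ))
      rw [le_div_iff₀ (by positivity)] at h1
      rw [div_lt_iff₀ (by positivity)] at h2
      simp only [z]
      constructor <;> nlinarith)
    refine ⟨φ c z, Set.mem_biUnion hc ⟨z, rfl⟩, ?_⟩
    rw [unitBall, Seminorm.mem_closedBall_zero]
    convert hyc using 2
    ext i
    simp [φ]
    ring
  refine (iInf_le _ (⟨X, hX⟩ : {X // IsCovering p X})).trans ?_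
  have hcount : ∀ R : ℝ, 0 < R → ((X ∩ cube d R).encard : ℝ≥0∞) * volume (unitBall p) /
      volume (cube d R)
      ≤ ENNReal.ofReal (F.card * (1 / ρ + R⁻¹) ^ d * ballVol p / 2 ^ d) := by
    intro R hR
    have h1 : (X ∩ cube d R).encard ≤ (F.card * ⌊(R / ρ + 1) ^ d⌋₊ : ℕ) := by
      have h2 : X ∩ cube d R ⊆ ⋃ c ∈ F, φ c '' {z | φ c z ∈ cube d R} := by
        rintro _ ⟨hx, hR⟩
        obtain ⟨c, hc, z, rfl⟩ := Set.mem_iUnion₂.1 hx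
        exact Set.mem_biUnion hc ⟨z, hR, rfl⟩
      refine (Set.encard_le_encard h2).trans ((Finset.set_encard_biUnion_le _ _).trans ?_)
      refine (Finset.sum_le_sum fun c _ => (Set.encard_image_le _ _).trans
        (encard_lattice_le hρ hR.le c)).trans ?_
      simp
    have h3 : ((X ∩ cube d R).encard : ℝ≥0∞) ≤ ENNReal.ofReal (F.card * (R / ρ + 1) ^ d) := by
      calc ((X ∩ cube d R).encard : ℝ≥0∞)
          ≤ (((F.card * ⌊(R / ρ + 1) ^ d⌋₊ : ℕ) : ℕ∞) : ℝ≥0∞) := by exact_mod_cast h1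
        _ = ENNReal.ofReal ((F.card * ⌊(R / ρ + 1) ^ d⌋₊ : ℕ) : ℝ) := by
            rw [ENNReal.ofReal_natCast]
            rfl
        _ ≤ _ := by
            refine ENNReal.ofReal_le_ofReal ?_
            push_cast
            gcongr
            exact Nat.floor_le (by positivity)
    rw [volume_unitBall hp, volume_cube d hR.le]
    calc _ ≤ ENNReal.ofReal (F.card * (R / ρ + 1) ^ d) * ENNReal.ofReal (ballVol p) /
          ENNReal.ofReal ((2 * R) ^ d) := by gcongr
      _ = ENNReal.ofReal (F.card * (R / ρ + 1) ^ d * ballVol p / (2 * R) ^ d) := by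
          rw [← ENNReal.ofReal_mul (by positivity), ← ENNReal.ofReal_div_of_pos (by positivity)]
      _ = _ := by
          congr 1
          have : R / ρ + 1 = (1 / ρ + R⁻¹) * R := by field_simp
          rw [this, mul_pow, mul_pow]
          field_simp
  have hlim : Tendsto (fun R : ℝ =>
      ENNReal.ofReal (F.card * (1 / ρ + R⁻¹) ^ d * ballVol p / 2 ^ d)) atTop
      (𝓝 (ENNReal.ofReal (F.card * (1 / ρ + 0) ^ d * ballVol p / 2 ^ d))) := by
    refine (ENNReal.continuous_ofReal.tendsto _).comp ?_
    exact (((tendsto_const_nhds.add tendsto_inv_atTop_zero).pow d).const_mul _ |>.mul_const _).div_const _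
  have heq : F.card * (1 / ρ + 0) ^ d * ballVol p / 2 ^ d = F.card * ballVol p / (2 * ρ) ^ d := by
    rw [add_zero, mul_pow, div_pow]
    field_simp
    simp
  rw [heq] at hlim
  rw [← hlim.liminf_eq]
  refine liminf_le_liminf ?_
  filter_upwards [eventually_gt_atTop 0] with R hR using hcount R hR

theorem Covers.smul {d : ℕ} {p : Seminorm ℝ (Fin d → ℝ)} {F : Finset (Fin d → ℝ)} {r s ρ : ℝ}
    (hs : 0 < s) (h : Covers p F r (cube d ρ)) :
    ∃ G : Finset (Fin d → ℝ), G.card ≤ F.card ∧ Covers p G (s * r) (cube d (s * ρ)) := by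
  classical
  refine ⟨F.image fun x => s • x, Finset.card_image_le, fun y hy => ?_⟩
  obtain ⟨x, hx, hxy⟩ := h (s⁻¹ • y) (mem_cube.2 fun i => by
    have := mem_cube.1 hy i
    rw [Pi.smul_apply, smul_eq_mul, inv_mul_le_iff₀ hs, le_inv_mul_iff₀ hs]
    constructor <;> linarith)
  refine ⟨s • x, Finset.mem_image_of_mem _ hx, ?_⟩
  have : y - s • x = s • (s⁻¹ • y - x) := by
    rw [smul_sub, smul_smul, mul_inv_cancel₀ hs.ne', one_smul]
  rw [this, map_smul_eq_mul, Real.norm_of_nonneg hs.le]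
  gcongr

theorem exists_covers_cube {d : ℕ} (p : Seminorm ℝ (Fin d → ℝ)) (ρ : ℝ) {r : ℝ} (hr : 0 < r) :
    ∃ F, Covers p F r (cube d ρ) := by
  obtain ⟨F, -, hF⟩ := (isCompact_Icc (a := fun _ : Fin d => -ρ) (b := fun _ => ρ)).elim_nhds_subcover
    (fun x => p.closedBall x r) fun x _ => closedBall_mem_nhds p x hr
  refine ⟨F, fun y hy => ?_⟩
  obtain ⟨x, hx, hyx⟩ := Set.mem_iUnion₂.1 (hF hy)
  exact ⟨x, hx, hyx⟩

theorem coveringConstant_ne_top {d : ℕ} {p : Seminorm ℝ (Fin d → ℝ)}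
    (hp : ∀ x, p x = 0 → x = 0) : coveringConstant p ≠ ∞ := by
  obtain ⟨F, hF⟩ := exists_covers_cube p 1 one_pos
  exact ((coveringConstant_le_of_covers hp one_pos hF).trans_lt ENNReal.ofReal_lt_top).ne

/-- The covering constant is a lower bound for the density of every covering of a cube by balls of
an arbitrary radius `r`, the density being the total volume of the balls over that of the cube. -/
theorem coveringConstant_mul_le {d : ℕ} {p : Seminorm ℝ (Fin d → ℝ)}
    (hp : ∀ x, p x = 0 → x = 0) {F : Finset (Fin d → ℝ)} {ρ r : ℝ} (hρ : 0 < ρ) (hr : 0 < r)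
    (h : Covers p F r (cube d ρ)) :
    (coveringConstant p).toReal * (2 * ρ) ^ d ≤ F.card * ballVol p * r ^ d := by
  have hβ := ballVol_pos hp
  obtain ⟨G, hGF, hG⟩ := h.smul (inv_pos.2 hr)
  rw [inv_mul_cancel₀ hr.ne'] at hG
  have h1 := ENNReal.toReal_le_of_le_ofReal (by positivity)
    (coveringConstant_le_of_covers hp (by positivity) hG)
  have h2 : (G.card : ℝ) ≤ F.card := by exact_mod_cast hGF
  rw [le_div_iff₀ (by positivity)] at h1
  have h3 : (2 * (r⁻¹ * ρ)) ^ d * r ^ d = (2 * ρ) ^ d := by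
    rw [← mul_pow]
    congr 1
    field_simp
  calc (coveringConstant p).toReal * (2 * ρ) ^ d
      = (coveringConstant p).toReal * (2 * (r⁻¹ * ρ)) ^ d * r ^ d := by rw [mul_assoc, h3]
    _ ≤ G.card * ballVol p * r ^ d := by gcongr
    _ ≤ _ := by gcongr

/-- Conversely, cubes can be covered by balls with a density close to the covering constant. -/
theorem exists_covers_cube_lt {d : ℕ} {p : Seminorm ℝ (Fin d → ℝ)}
    (hp : ∀ x, p x = 0 → x = 0) {t : ℝ} (ht : (coveringConstant p).toReal < t) :
    ∃ ρ : ℝ, 0 < ρ ∧ ∃ F : Finset (Fin d → ℝ), Covers p F 1 (cube d ρ) ∧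
      F.card * ballVol p < t * (2 * ρ) ^ d := by
  classical
  have hβ := ballVol_pos hp
  obtain ⟨a, ha, hap⟩ := exists_norm_le_mul p hp
  obtain ⟨s, hs, hst⟩ := exists_between ht
  have hs0 : 0 < s := ENNReal.toReal_nonneg.trans_lt hs
  have h1 : coveringConstant p < ENNReal.ofReal s :=
    (ENNReal.lt_ofReal_iff_toReal_lt (coveringConstant_ne_top hp)).2 hs
  obtain ⟨⟨X, hX⟩, hXs⟩ := iInf_lt_iff.1 h1
  have hfreq := frequently_lt_of_liminf_lt (by isBoundedDefault) hXs
  have hlim : Tendsto (fun R : ℝ => t * (1 - a * R⁻¹) ^ d) atTop (𝓝 (t * (1 - a * 0) ^ d)) :=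
    ((tendsto_const_nhds.sub (tendsto_inv_atTop_zero.const_mul a)).pow d).const_mul t
  have hev := hlim.eventually (lt_mem_nhds (show s < t * (1 - a * 0) ^ d by simpa using hst))
  obtain ⟨R, hR, hRs, hRa⟩ := (hfreq.and_eventually (hev.and (eventually_gt_atTop a))).exists
  have hR0 : 0 < R := ha.trans hRa
  rw [volume_unitBall hp, volume_cube d hR0.le, ENNReal.div_lt_iff
    (Or.inl (by rw [Ne, ENNReal.ofReal_eq_zero, not_le]; positivity)) (Or.inl ENNReal.ofReal_ne_top),
    ← ENNReal.ofReal_mul hs0.le] at hR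
  have hfin : (X ∩ cube d R).Finite := by
    rw [← Set.encard_ne_top_iff]
    intro htop
    rw [htop, ENat.toENNReal_top, ENNReal.top_mul (by simpa using hβ)] at hR
    exact not_top_lt hR
  -- Unit balls centred outside `[-R, R]^d` do not reach the cube `[-(R - a), R - a]^d`.
  refine ⟨R - a, by linarith, hfin.toFinset, fun y hy => ?_, ?_⟩
  · obtain ⟨x, hx, hyx⟩ := hX y
    rw [unitBall, Seminorm.mem_closedBall_zero] at hyx
    refine ⟨x, hfin.mem_toFinset.2 ⟨hx, mem_cube.2 fun i => ?_⟩, hyx⟩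
    have h2 := mem_cube.1 hy i
    have h3 := abs_le.1 (((norm_le_pi_norm (y - x) i).trans (hap _)).trans
      (mul_le_of_le_one_right ha.le hyx))
    rw [Pi.sub_apply] at h3
    constructor <;> linarith
  · have h2 : (hfin.toFinset.card : ℝ) * ballVol p < s * (2 * R) ^ d := by
      rw [hfin.encard_eq_coe_toFinset_card, ENat.toENNReal_coe, ← ENNReal.ofReal_natCast,
        ← ENNReal.ofReal_mul (Nat.cast_nonneg _)] at hR
      exact (ENNReal.ofReal_lt_ofReal_iff (by positivity)).1 hR
    have h3 : t * (1 - a * R⁻¹) ^ d * (2 * R) ^ d = t * (2 * (R - a)) ^ d := by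
      rw [mul_assoc, ← mul_pow]
      congr 2
      field_simp
    rw [← h3]
    refine h2.trans ?_
    gcongr

theorem one_le_toReal_coveringConstant {d : ℕ} {p : Seminorm ℝ (Fin d → ℝ)}
    (hp : ∀ x, p x = 0 → x = 0) : 1 ≤ (coveringConstant p).toReal := by
  refine le_of_forall_gt_imp_ge_of_dense fun t ht => ?_
  obtain ⟨ρ, hρ, F, hF, hlt⟩ := exists_covers_cube_lt hp ht
  have h1 := hF.volume_le hp one_pos
  have hβ := ballVol_pos hp
  rw [volume_cube d hρ.le, ENNReal.ofReal_le_ofReal_iff (by positivity), one_pow, one_mul] at h1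
  have h2 : 0 < (2 * ρ) ^ d := by positivity
  by_contra! h3
  nlinarith

/-! ### Coverings of Jordan measurable sets by small balls -/

/-- The cells of the grid of mesh size `2 * h` that meet a bounded set `S` are disjoint and lie within
distance `2 * h` of `S`, which bounds their number. The centre of the cell `z` is `2 * h * z`. -/
theorem exists_tiles {d : ℕ} {S : Set (Fin d → ℝ)} (hS : Bornology.IsBounded S) {h : ℝ}
    (hh : 0 < h) :
    ∃ T : Finset (Fin d → ℤ), (∀ y ∈ S, ∃ z ∈ T, (fun i => y i - 2 * h * z i) ∈ cube d h) ∧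
      T.card * (2 * h) ^ d ≤ volume.real (Metric.cthickening (2 * h) S) := by
  classical
  -- Half-open cells, so that distinct cells are disjoint.
  let tile : (Fin d → ℤ) → Set (Fin d → ℝ) := fun z =>
    Set.univ.pi fun i => Set.Ico (h * (2 * z i - 1)) (h * (2 * z i + 1))
  have htile : ∀ z y, y ∈ tile z ↔ ∀ i, ⌊(y i + h) / (2 * h)⌋ = z i := by
    intro z y
    simp only [tile, Set.mem_univ_pi, Set.mem_Ico, Int.floor_eq_iff]
    refine forall_congr' fun i => ?_
    rw [le_div_iff₀ (by positivity), div_lt_iff₀ (by positivity)]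
    constructor <;> rintro ⟨h1, h2⟩ <;> constructor <;> linarith
  have hvol : ∀ z, volume (tile z) = ENNReal.ofReal ((2 * h) ^ d) := by
    intro z
    rw [Real.volume_pi_Ico, ENNReal.ofReal_pow (by positivity)]
    have : ∀ i, h * (2 * (z i : ℝ) + 1) - h * (2 * z i - 1) = 2 * h := fun i => by ring
    simp [this]
  have hfinvol : volume (Metric.cthickening (2 * h) S) ≠ ∞ := hS.cthickening.measure_lt_top.ne
  have hcard : ∀ T : Finset (Fin d → ℤ), (∀ z ∈ T, (tile z ∩ S).Nonempty) →
      T.card * (2 * h) ^ d ≤ volume.real (Metric.cthickening (2 * h) S) := by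
    intro T hT
    have h1 : volume (⋃ z ∈ T, tile z) = ∑ z ∈ T, volume (tile z) := by
      refine measure_biUnion_finset (fun z _ w _ hzw => Set.disjoint_left.2 fun y hy hy' => ?_)
        fun z _ => MeasurableSet.univ_pi fun i => measurableSet_Ico
      exact hzw (funext fun i => ((htile z y).1 hy i).symm.trans ((htile w y).1 hy' i))
    have h2 : volume (⋃ z ∈ T, tile z) ≤ volume (Metric.cthickening (2 * h) S) := by
      refine measure_mono (Set.iUnion₂_subset fun z hz y hy => ?_)
      obtain ⟨s, hs, hsS⟩ := hT z hz
      refine Metric.mem_cthickening_of_dist_le y s _ S hsS ?_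
      refine (dist_pi_le_iff (by positivity)).2 fun i => ?_
      have h3 := hs i (Set.mem_univ i)
      have h4 := hy i (Set.mem_univ i)
      rw [Set.mem_Ico] at h3 h4
      rw [Real.dist_eq, abs_le]
      constructor <;> linarith
    simp only [h1, hvol, Finset.sum_const, nsmul_eq_mul] at h2
    rw [← ENNReal.ofReal_natCast, ← ENNReal.ofReal_mul (Nat.cast_nonneg _)] at h2
    exact (ENNReal.ofReal_le_iff_le_toReal hfinvol).1 h2
  have hfin : {z | (tile z ∩ S).Nonempty}.Finite := by
    by_contra hinf
    obtain ⟨T, hT, hTc⟩ := Set.Infinite.exists_subset_card_eq hinf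
      (⌊volume.real (Metric.cthickening (2 * h) S) / (2 * h) ^ d⌋₊ + 1)
    have h1 := hcard T fun z hz => hT hz
    rw [← le_div_iff₀ (by positivity)] at h1
    have h2 := Nat.le_floor h1
    omega
  refine ⟨hfin.toFinset, fun y hy => ?_, hcard _ fun z hz => hfin.mem_toFinset.1 hz⟩
  have hyt : y ∈ tile fun i => ⌊(y i + h) / (2 * h)⌋ := (htile _ y).2 fun i => rfl
  refine ⟨_, hfin.mem_toFinset.2 ⟨y, hyt, hy⟩, mem_cube.2 fun i => ?_⟩
  have h1 := hyt i (Set.mem_univ i)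
  rw [Set.mem_Ico] at h1
  constructor <;> linarith

/-- Filling the small grid cells that meet `S` with scaled copies of a good covering of a cube. -/
theorem eventually_exists_covers {d : ℕ} {p : Seminorm ℝ (Fin d → ℝ)}
    (hp : ∀ x, p x = 0 → x = 0) {S : Set (Fin d → ℝ)} (hS : Bornology.IsBounded S) {t : ℝ}
    (ht : (coveringConstant p).toReal * volume.real (closure S) < t) :
    ∀ᶠ δ in 𝓝[>] (0 : ℝ), ∃ F : Finset (Fin d → ℝ), Covers p F δ S ∧
      F.card * ballVol p * δ ^ d < t := by
  classical
  have hβ := ballVol_pos hp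
  obtain ⟨t', ht', htt'⟩ : ∃ t', t' * volume.real (closure S) < t ∧
      (coveringConstant p).toReal < t' := by
    have h1 := ((continuous_id.mul_const (volume.real (closure S))).tendsto
      (coveringConstant p).toReal).eventually (gt_mem_nhds ht)
    exact ((h1.filter_mono nhdsWithin_le_nhds).and
      (self_mem_nhdsWithin (s := Set.Ioi (coveringConstant p).toReal))).exists
  obtain ⟨ρ, hρ, F, hF, hFt⟩ := exists_covers_cube_lt hp htt'
  have ht'0 : 0 ≤ t' := ENNReal.toReal_nonneg.trans htt'.le
  have hlim : Tendsto (fun δ : ℝ => t' * volume.real (Metric.cthickening (2 * (δ * ρ)) S))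
      (𝓝[>] 0) (𝓝 (t' * volume.real (closure S))) := by
    have h1 := tendsto_measure_cthickening (μ := volume) (s := S)
      ⟨1, one_pos, hS.cthickening.measure_lt_top.ne⟩
    have h2 : Tendsto (fun δ : ℝ => 2 * (δ * ρ)) (𝓝[>] 0) (𝓝 0) := by
      have : Continuous fun δ : ℝ => 2 * (δ * ρ) := by fun_prop
      simpa using (this.tendsto 0).mono_left nhdsWithin_le_nhds
    exact ((ENNReal.tendsto_toReal hS.closure.measure_lt_top.ne).comp (h1.comp h2)).const_mul t'
  filter_upwards [hlim.eventually (gt_mem_nhds ht'), self_mem_nhdsWithin] with δ hδt hδ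
  rw [Set.mem_Ioi] at hδ
  obtain ⟨T, hT, hTc⟩ := exists_tiles hS (mul_pos hδ hρ)
  obtain ⟨G, hGF, hG⟩ := hF.smul hδ
  rw [mul_one] at hG
  refine ⟨(T ×ˢ G).image fun q i => q.2 i + 2 * (δ * ρ) * q.1 i, fun y hy => ?_, ?_⟩
  · obtain ⟨z, hz, hyz⟩ := hT y hy
    obtain ⟨x, hx, hxy⟩ := hG _ hyz
    refine ⟨_, Finset.mem_image_of_mem _ (Finset.mk_mem_product hz hx), ?_⟩
    convert hxy using 2
    ext i
    simp only [Pi.sub_apply]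
    ring
  · refine lt_of_le_of_lt ?_ hδt
    have h1 : (((T ×ˢ G).image fun q i => q.2 i + 2 * (δ * ρ) * q.1 i).card : ℝ)
        ≤ T.card * F.card := by
      have := Finset.card_image_le (s := T ×ˢ G) (f := fun q i => q.2 i + 2 * (δ * ρ) * q.1 i)
      rw [Finset.card_product] at this
      exact_mod_cast this.trans (Nat.mul_le_mul_left _ hGF)
    calc _ ≤ T.card * F.card * ballVol p * δ ^ d := by gcongr
      _ = T.card * δ ^ d * (F.card * ballVol p) := by ring
      _ ≤ T.card * δ ^ d * (t' * (2 * ρ) ^ d) := by gcongr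
      _ = t' * (T.card * (2 * (δ * ρ)) ^ d) := by rw [mul_pow, mul_pow, mul_pow]; ring
      _ ≤ _ := by gcongr

/-- A segment from a point of `D` to a point outside `D` meets the boundary of `D`. -/
theorem exists_mem_segment_frontier {d : ℕ} {D : Set (Fin d → ℝ)} {x y : Fin d → ℝ} (hx : x ∉ D)
    (hy : y ∈ D) : ∃ w ∈ segment ℝ y x, w ∈ frontier D := by
  by_contra! h
  have hpre : IsPreconnected (segment ℝ y x) := (convex_segment y x).isPreconnected
  have hint : ∀ w ∈ segment ℝ y x, w ∈ interior D ∨ w ∈ interior Dᶜ := by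
    intro w hw
    by_contra! hc
    refine h w hw ⟨?_, hc.1⟩
    rw [interior_compl, Set.mem_compl_iff, not_not] at hc
    exact hc.2
  obtain ⟨w, -, hw1, hw2⟩ := hpre _ _ isOpen_interior isOpen_interior hint
    ⟨y, left_mem_segment ℝ y x, (hint y (left_mem_segment ℝ y x)).resolve_right fun hc =>
      interior_subset hc hy⟩
    ⟨x, right_mem_segment ℝ y x, (hint x (right_mem_segment ℝ y x)).resolve_left fun hc =>
      hx (interior_subset hc)⟩
  exact interior_subset hw2 (interior_subset hw1)

theorem IsJordanMeasurable.volume_closure {d : ℕ} {D : Set (Fin d → ℝ)}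
    (hD : IsJordanMeasurable D) : volume (closure D) = volume D := by
  refine le_antisymm ?_ (measure_mono subset_closure)
  rw [closure_eq_self_union_frontier]
  refine (measure_union_le _ _).trans ?_
  rw [hD.2, add_zero]

theorem IsJordanMeasurable.volume_interior {d : ℕ} {D : Set (Fin d → ℝ)}
    (hD : IsJordanMeasurable D) : volume (interior D) = volume D := by
  refine le_antisymm (measure_mono interior_subset) ?_
  rw [← hD.volume_closure, closure_eq_interior_union_frontier]
  refine (measure_union_le _ _).trans ?_
  rw [hD.2, add_zero]

/-- For a Jordan measurable set the centres can be taken inside the set: a ball with its centre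
outside is only needed near the boundary, and the points of `D` near the boundary are covered by
negligibly many balls. -/
theorem IsJordanMeasurable.eventually_exists_covers_subset {d : ℕ}
    {p : Seminorm ℝ (Fin d → ℝ)} (hp : ∀ x, p x = 0 → x = 0) {D : Set (Fin d → ℝ)}
    (hD : IsJordanMeasurable D) {t : ℝ} (ht : (coveringConstant p).toReal * volume.real D < t) :
    ∀ᶠ δ in 𝓝[>] (0 : ℝ), ∃ F : Finset (Fin d → ℝ), ↑F ⊆ D ∧ Covers p F δ D ∧
      F.card * ballVol p * δ ^ d < t := by
  classical
  have hβ := ballVol_pos hp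
  obtain ⟨a, ha, hap⟩ := exists_norm_le_mul p hp
  obtain ⟨s, hs, hst⟩ := exists_between ht
  have hbdd : Bornology.IsBounded (frontier D) := hD.1.closure.subset frontier_subset_closure
  have hlim : Tendsto (fun δ : ℝ => 2 ^ d * volume.real (Metric.cthickening (2 * a * δ)
      (frontier D))) (𝓝[>] 0) (𝓝 (2 ^ d * volume.real (frontier D))) := by
    have h1 := tendsto_measure_cthickening_of_isClosed (μ := volume) (s := frontier D)
      ⟨1, one_pos, hbdd.cthickening.measure_lt_top.ne⟩ isClosed_frontier
    have h2 : Tendsto (fun δ : ℝ => 2 * a * δ) (𝓝[>] 0) (𝓝 0) := by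
      have : Continuous fun δ : ℝ => 2 * a * δ := by fun_prop
      simpa using (this.tendsto 0).mono_left nhdsWithin_le_nhds
    exact ((ENNReal.tendsto_toReal hbdd.measure_lt_top.ne).comp (h1.comp h2)).const_mul _
  have hzero : 2 ^ d * volume.real (frontier D) < t - s := by
    rw [measureReal_def, hD.2]
    simpa using hst
  have hcl : volume.real (closure D) = volume.real D := by
    rw [measureReal_def, hD.volume_closure, measureReal_def]
  rw [← hcl] at hs
  filter_upwards [hlim.eventually (gt_mem_nhds hzero), self_mem_nhdsWithin,
    eventually_exists_covers hp hD.1 hs] with δ hδ1 hδ ⟨F, hF, hFs⟩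
  rw [Set.mem_Ioi] at hδ
  obtain ⟨G, hGD, hG, hGc⟩ := exists_covers_of_packing hp
    (S := D ∩ Metric.cthickening (a * δ) (frontier D))
    (W := Metric.cthickening (2 * a * δ) (frontier D)) (half_pos hδ)
    hbdd.cthickening.measure_lt_top.ne (by
      rintro x ⟨-, hx⟩ y hy
      have h1 : y ∈ Metric.cthickening (a * δ) (Metric.cthickening (a * δ) (frontier D)) := by
        refine Metric.mem_cthickening_of_dist_le y x _ _ hx ?_
        rw [dist_eq_norm]
        refine (hap _).trans ?_
        rw [Seminorm.mem_closedBall] at hy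
        gcongr
        linarith
      have h2 := Metric.cthickening_cthickening_subset (by positivity) (by positivity) _ h1
      rwa [← two_mul, ← mul_assoc] at h2)
  rw [mul_div_cancel₀ _ two_ne_zero] at hG
  refine ⟨F.filter (· ∈ D) ∪ G, ?_, fun y hy => ?_, ?_⟩
  · intro x hx
    rcases Finset.mem_union.1 (Finset.mem_coe.1 hx) with h | h
    · exact (Finset.mem_filter.1 h).2
    · exact (hGD h).1
  · obtain ⟨x, hx, hyx⟩ := hF y hy
    by_cases hxD : x ∈ D
    · exact ⟨x, Finset.mem_union_left _ (Finset.mem_filter.2 ⟨hx, hxD⟩), hyx⟩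
    · obtain ⟨w, hw, hwD⟩ := exists_mem_segment_frontier hxD hy
      have h1 : dist y w ≤ a * δ := by
        obtain ⟨u, v, hu, hv, huv, rfl⟩ := hw
        have : y - (u • y + v • x) = v • (y - x) := by
          obtain rfl : u = 1 - v := by linarith
          module
        rw [dist_eq_norm, this, norm_smul, Real.norm_of_nonneg hv]
        calc v * ‖y - x‖ ≤ 1 * ‖y - x‖ := by
              gcongr
              linarith
          _ ≤ a * δ := by
              rw [one_mul]
              exact (hap _).trans (by gcongr)
      obtain ⟨c, hc, hyc⟩ := hG y ⟨hy, Metric.mem_cthickening_of_dist_le y w _ _ hwD h1⟩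
      exact ⟨c, Finset.mem_union_right _ hc, hyc⟩
  · have h1 : ((F.filter (· ∈ D) ∪ G).card : ℝ) ≤ F.card + G.card := by
      exact_mod_cast (Finset.card_union_le _ _).trans
        (Nat.add_le_add_right (Finset.card_filter_le _ _) _)
    have h2 : G.card * ballVol p * δ ^ d
        ≤ 2 ^ d * volume.real (Metric.cthickening (2 * a * δ) (frontier D)) := by
      calc G.card * ballVol p * δ ^ d = 2 ^ d * (G.card * ((δ / 2) ^ d * ballVol p)) := by
            rw [div_pow]
            field_simp
        _ ≤ _ := by gcongr
    calc ((F.filter (· ∈ D) ∪ G).card : ℝ) * ballVol p * δ ^ d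
        ≤ (F.card + G.card) * ballVol p * δ ^ d := by gcongr
      _ = F.card * ballVol p * δ ^ d + G.card * ballVol p * δ ^ d := by ring
      _ < t := by linarith

/-- A covering of `D` that is too sparse, together with an almost optimal covering of the rest of a
cube containing `D`, would contradict the definition of the covering constant. -/
theorem IsJordanMeasurable.eventually_lt_of_covers {d : ℕ} {p : Seminorm ℝ (Fin d → ℝ)}
    (hp : ∀ x, p x = 0 → x = 0) {D : Set (Fin d → ℝ)} (hD : IsJordanMeasurable D) {t : ℝ}
    (ht : t < (coveringConstant p).toReal * volume.real D) :
    ∀ᶠ δ in 𝓝[>] (0 : ℝ), ∀ F : Finset (Fin d → ℝ), Covers p F δ D →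
      t < F.card * ballVol p * δ ^ d := by
  classical
  obtain ⟨R, hR⟩ := hD.1.subset_closedBall 0
  let ρ : ℝ := max R 1
  have hρ : 0 < ρ := lt_max_of_lt_right one_pos
  have hDρ : D ⊆ cube d ρ := by
    intro x hx
    have h1 : ‖x‖ ≤ ρ := by
      have := hR hx
      rw [mem_closedBall_zero_iff] at this
      exact this.trans (le_max_left _ _)
    exact mem_cube.2 fun i => abs_le.1 ((norm_le_pi_norm x i).trans h1)
  have hcubeb : Bornology.IsBounded (cube d ρ) := Metric.isBounded_Icc _ _
  have hcl : volume.real (closure (cube d ρ \ D)) ≤ (2 * ρ) ^ d - volume.real D := by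
    have h1 : closure (cube d ρ \ D) ⊆ cube d ρ \ interior D :=
      closure_minimal (Set.sdiff_subset_sdiff_right interior_subset)
        (isClosed_Icc.sdiff isOpen_interior)
    have h2 : volume.real (cube d ρ \ interior D) = (2 * ρ) ^ d - volume.real D := by
      rw [measureReal_sdiff (interior_subset.trans hDρ) isOpen_interior.measurableSet
        hcubeb.measure_lt_top.ne, measureReal_def, volume_cube d hρ.le, measureReal_def,
        hD.volume_interior, ENNReal.toReal_ofReal (by positivity), measureReal_def]
    rw [← h2]
    exact measureReal_mono h1 (hcubeb.subset Set.sdiff_subset).measure_lt_top.ne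
  have hθ : 0 < (coveringConstant p).toReal :=
    one_pos.trans_le (one_le_toReal_coveringConstant hp)
  have hlt : (coveringConstant p).toReal * volume.real (closure (cube d ρ \ D)) <
      (coveringConstant p).toReal * (2 * ρ) ^ d - t := by
    have := mul_le_mul_of_nonneg_left hcl hθ.le
    linarith
  filter_upwards [eventually_exists_covers hp (hcubeb.subset Set.sdiff_subset) hlt,
    self_mem_nhdsWithin] with δ ⟨G, hG, hGt⟩ hδ F hF
  have h1 : Covers p (F ∪ G) δ (cube d ρ) :=
    (hF.union hG).mono subset_rfl le_rfl (Set.union_sdiff_cancel hDρ).ge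
  have h2 := coveringConstant_mul_le hp hρ hδ h1
  have hβ := ballVol_pos hp
  rw [Set.mem_Ioi] at hδ
  have h3 : ((F ∪ G).card : ℝ) * ballVol p * δ ^ d
      ≤ F.card * ballVol p * δ ^ d + G.card * ballVol p * δ ^ d := by
    have : ((F ∪ G).card : ℝ) ≤ F.card + G.card := by exact_mod_cast Finset.card_union_le _ _
    rw [← add_mul, ← add_mul]
    gcongr
  linarith

/-! ### Asymptotics and sharp lower bound of the minimal error -/

theorem ofReal_toReal_coveringConstant {d : ℕ} {p : Seminorm ℝ (Fin d → ℝ)}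
    (hp : ∀ x, p x = 0 → x = 0) :
    coveringConstant p = ENNReal.ofReal (coveringConstant p).toReal :=
  (ENNReal.ofReal_toReal (coveringConstant_ne_top hp)).symm

theorem volume_real_pos_of_mem_domains {d : ℕ} {D : Set (Fin d → ℝ)} (hD : D ∈ domains d) :
    0 < volume.real D := by
  refine ENNReal.toReal_pos ?_ hD.1.1.measure_lt_top.ne
  exact (Measure.measure_pos_of_nonempty_interior volume hD.2).ne'

theorem volume_eq_ofReal_of_mem_domains {d : ℕ} {D : Set (Fin d → ℝ)} (hD : D ∈ domains d) :
    volume D = ENNReal.ofReal (volume.real D) :=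
  (ENNReal.ofReal_toReal hD.1.1.measure_lt_top.ne).symm

theorem tendsto_minError_div {d : ℕ} (hd : 1 ≤ d) {p : Seminorm ℝ (Fin d → ℝ)}
    (hp : ∀ x, p x = 0 → x = 0) {D : Set (Fin d → ℝ)} (hD : D ∈ domains d) :
    Tendsto (fun n : ℕ => minError p D n /
        (coveringConstant p ^ (1 / (d : ℝ)) *
          (volume D / volume (unitBall p)) ^ (1 / (d : ℝ)) *
          (n : ℝ≥0∞) ^ (-(1 / (d : ℝ)))))
      atTop (𝓝 1) := by
  have hβ := ballVol_pos hp
  have hv := volume_real_pos_of_mem_domains hD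
  have hθ : 0 < (coveringConstant p).toReal :=
    one_pos.trans_le (one_le_toReal_coveringConstant hp)
  have hd0 : (0 : ℝ) < d := by exact_mod_cast hd
  have hdne : d ≠ 0 := by omega
  set θ := (coveringConstant p).toReal with hθdef
  set v := volume.real D with hvdef
  set β := ballVol p with hβdef
  -- The denominator as a real number: `n` balls of radius `δ n` have total volume `θ * λ(D)`.
  let δ : ℕ → ℝ := fun n => (θ * v / β) ^ (1 / (d : ℝ)) * (n : ℝ) ^ (-(1 / (d : ℝ)))
  have hκ : 0 < (θ * v / β) ^ (1 / (d : ℝ)) := by positivity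
  have hδpos : ∀ n : ℕ, 1 ≤ n → 0 < δ n := fun n hn => by
    have : (0 : ℝ) < n := by exact_mod_cast hn
    positivity
  have hδpow : ∀ n : ℕ, 1 ≤ n → n * β * δ n ^ d = θ * v := by
    intro n hn
    have hn0 : (0 : ℝ) < n := by exact_mod_cast hn
    have h1 : ((θ * v / β) ^ (1 / (d : ℝ))) ^ d = θ * v / β := by
      rw [one_div]
      exact Real.rpow_inv_natCast_pow (by positivity) hdne
    have h2 : ((n : ℝ) ^ (-(1 / (d : ℝ)))) ^ d = (n : ℝ)⁻¹ := by
      rw [Real.rpow_neg hn0.le, inv_pow, one_div, Real.rpow_inv_natCast_pow hn0.le hdne]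
    simp only [δ]
    rw [mul_pow, h1, h2]
    field_simp
  have hden : ∀ n : ℕ, 1 ≤ n → coveringConstant p ^ (1 / (d : ℝ)) *
      (volume D / volume (unitBall p)) ^ (1 / (d : ℝ)) * (n : ℝ≥0∞) ^ (-(1 / (d : ℝ))) =
      ENNReal.ofReal (δ n) := by
    intro n hn
    have hn0 : (0 : ℝ) < n := by exact_mod_cast hn
    rw [ofReal_toReal_coveringConstant hp, volume_eq_ofReal_of_mem_domains hD,
      volume_unitBall hp, ← ENNReal.ofReal_natCast, ← ENNReal.ofReal_div_of_pos hβ,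
      ENNReal.ofReal_rpow_of_pos hθ, ENNReal.ofReal_rpow_of_pos (by positivity),
      ENNReal.ofReal_rpow_of_pos hn0, ← ENNReal.ofReal_mul (by positivity),
      ← ENNReal.ofReal_mul (by positivity), ← Real.mul_rpow hθ.le (by positivity), ← mul_div_assoc]
  have hδlim : Tendsto δ atTop (𝓝 0) := by
    have h1 : Tendsto (fun n : ℕ => (n : ℝ) ^ (-(1 / (d : ℝ)))) atTop (𝓝 0) :=
      (tendsto_rpow_neg_atTop (by positivity)).comp tendsto_natCast_atTop_atTop
    simpa [δ] using h1.const_mul ((θ * v / β) ^ (1 / (d : ℝ)))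
  have hscale : ∀ s : ℝ, 0 < s → Tendsto (fun n => s * δ n) atTop (𝓝[>] 0) := by
    intro s hs
    refine tendsto_nhdsWithin_iff.2 ⟨by simpa using hδlim.const_mul s, ?_⟩
    filter_upwards [eventually_ge_atTop 1] with n hn using mul_pos hs (hδpos n hn)
  have hupper : ∀ s : ℝ, 1 < s → ∀ᶠ n : ℕ in atTop, minError p D n ≤ ENNReal.ofReal (s * δ n) := by
    intro s hs
    have hs0 : 0 < s := one_pos.trans hs
    have ht : θ * v < s ^ d * (θ * v) :=
      lt_mul_of_one_lt_left (by positivity) (one_lt_pow₀ hs hdne)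
    filter_upwards [(hscale s hs0).eventually (hD.1.eventually_exists_covers_subset hp ht),
      eventually_ge_atTop 1] with n ⟨F, hFD, hF, hFt⟩ hn
    refine minError_le_of_covers (hD.2.mono interior_subset) hFD ?_ hF
    have h1 : F.card * β * (s * δ n) ^ d < n * β * (s * δ n) ^ d := by
      refine hFt.trans_eq ?_
      rw [← hδpow n hn, mul_pow]
      ring
    have h2 : 0 < (s * δ n) ^ d := pow_pos (mul_pos hs0 (hδpos n hn)) d
    have h3 := lt_of_mul_lt_mul_right (lt_of_mul_lt_mul_right h1 h2.le) hβ.le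
    exact_mod_cast h3.le
  have hlower : ∀ s : ℝ, 0 < s → s < 1 →
      ∀ᶠ n : ℕ in atTop, ENNReal.ofReal (s * δ n) ≤ minError p D n := by
    intro s hs0 hs
    have ht : s ^ d * (θ * v) < θ * v :=
      mul_lt_of_lt_one_left (by positivity) (pow_lt_one₀ hs0.le hs hdne)
    filter_upwards [(hscale s hs0).eventually (hD.1.eventually_lt_of_covers hp ht),
      eventually_ge_atTop 1] with n hcov hn
    by_contra! hlt
    obtain ⟨F, -, hFn, hF⟩ := exists_covers_of_minError_lt hn hlt
    have h1 := hcov F hF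
    have h2 : 0 < (s * δ n) ^ d := pow_pos (mul_pos hs0 (hδpos n hn)) d
    have h3 : F.card * β * (s * δ n) ^ d ≤ n * β * (s * δ n) ^ d := by
      have : (F.card : ℝ) ≤ n := by exact_mod_cast hFn
      gcongr
    have h4 : n * β * (s * δ n) ^ d = s ^ d * (θ * v) := by
      rw [← hδpow n hn, mul_pow]
      ring
    linarith
  rw [tendsto_order]
  constructor
  · intro a ha
    obtain ⟨s, has, hs1⟩ := exists_between ha
    have hsne : s ≠ ∞ := (hs1.trans_le le_top).ne
    have hs0 : 0 < s.toReal := ENNReal.toReal_pos (pos_of_gt has).ne' hsne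
    have hs1' : s.toReal < 1 := by simpa using (ENNReal.toReal_lt_toReal hsne ENNReal.one_ne_top).2 hs1
    filter_upwards [hlower _ hs0 hs1', eventually_ge_atTop 1] with n hn hn1
    refine has.trans_le ?_
    rw [hden n hn1, ENNReal.le_div_iff_mul_le (Or.inl (by simpa using hδpos n hn1))
      (Or.inl ENNReal.ofReal_ne_top)]
    rwa [ENNReal.ofReal_mul hs0.le, ENNReal.ofReal_toReal hsne] at hn
  · intro b hb
    obtain ⟨s, hs1, hsb⟩ := exists_between hb
    have hsne : s ≠ ∞ := (hsb.trans_le le_top).ne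
    have hs1' : 1 < s.toReal := by simpa using (ENNReal.toReal_lt_toReal ENNReal.one_ne_top hsne).2 hs1
    filter_upwards [hupper _ hs1', eventually_ge_atTop 1] with n hn hn1
    refine lt_of_le_of_lt ?_ hsb
    rw [hden n hn1]
    refine ENNReal.div_le_of_le_mul ?_
    rwa [ENNReal.ofReal_mul (one_pos.trans hs1').le, ENNReal.ofReal_toReal hsne] at hn

/-- The volume of `n` balls that cover `D` is at least that of `D`. -/
theorem rpow_le_minError_mul {d : ℕ} (hd : 1 ≤ d) {p : Seminorm ℝ (Fin d → ℝ)}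
    (hp : ∀ x, p x = 0 → x = 0) {D : Set (Fin d → ℝ)} (hD : D ∈ domains d) {n : ℕ} (hn : 1 ≤ n) :
    volume (unitBall p) ^ (-(1 / (d : ℝ))) * (n : ℝ≥0∞) ^ (-(1 / (d : ℝ))) ≤
      minError p D n * volume D ^ (-(1 / (d : ℝ))) := by
  have hβ := ballVol_pos hp
  have hv := volume_real_pos_of_mem_domains hD
  have hn0 : (0 : ℝ) < n := by exact_mod_cast hn
  have hd0 : (0 : ℝ) < d := by exact_mod_cast hd
  have hdne : d ≠ 0 := by omega
  set v := volume.real D with hvdef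
  set β := ballVol p with hβdef
  have hlow : ENNReal.ofReal ((v / (n * β)) ^ (1 / (d : ℝ))) ≤ minError p D n := by
    by_contra! hlt
    obtain ⟨r, hr, hrlt⟩ : ∃ r : ℝ, minError p D n < ENNReal.ofReal r ∧
        r < (v / (n * β)) ^ (1 / (d : ℝ)) := by
      obtain ⟨s, hs1, hs2⟩ := exists_between hlt
      have hsne : s ≠ ∞ := (hs2.trans_le le_top).ne
      exact ⟨s.toReal, by rwa [ENNReal.ofReal_toReal hsne],
        (ENNReal.lt_ofReal_iff_toReal_lt hsne).1 hs2⟩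
    have hr0 : 0 < r := ENNReal.ofReal_pos.1 (pos_of_gt hr)
    obtain ⟨F, -, hFn, hF⟩ := exists_covers_of_minError_lt hn hr
    have h1 := hF.volume_le hp hr0
    rw [volume_eq_ofReal_of_mem_domains hD, ENNReal.ofReal_le_ofReal_iff (by positivity)] at h1
    have h2 : r ^ d < v / (n * β) := by
      have := pow_lt_pow_left₀ hrlt hr0.le hdne
      rwa [one_div, Real.rpow_inv_natCast_pow (by positivity) hdne] at this
    rw [lt_div_iff₀ (by positivity)] at h2
    have h3 : F.card * (r ^ d * β) ≤ n * (r ^ d * β) := by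
      have : (F.card : ℝ) ≤ n := by exact_mod_cast hFn
      gcongr
    linarith
  refine le_trans (le_of_eq ?_) (mul_le_mul_left hlow _)
  rw [volume_unitBall hp, volume_eq_ofReal_of_mem_domains hD, ← ENNReal.ofReal_natCast,
    ENNReal.ofReal_rpow_of_pos hβ, ENNReal.ofReal_rpow_of_pos hn0, ENNReal.ofReal_rpow_of_pos hv,
    ← ENNReal.ofReal_mul (by positivity), ← ENNReal.ofReal_mul (by positivity)]
  congr 1
  rw [Real.div_rpow hv.le (by positivity), Real.mul_rpow hn0.le hβ.le, Real.rpow_neg hβ.le,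
    Real.rpow_neg hn0.le, Real.rpow_neg hv.le]
  field_simp

theorem iUnion_closedBall_mem_domains {d n : ℕ} (hn : 1 ≤ n) {p : Seminorm ℝ (Fin d → ℝ)}
    (hp : ∀ x, p x = 0 → x = 0) {r : ℝ} (hr : 0 < r) (c : Fin n → Fin d → ℝ) :
    (⋃ i, p.closedBall (c i) r) ∈ domains d := by
  refine ⟨⟨Bornology.isBounded_iUnion.2 fun i => isBounded_closedBall hp _ _, ?_⟩, c ⟨0, hn⟩, ?_⟩
  · have hcl : IsClosed (⋃ i, p.closedBall (c i) r) :=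
      isClosed_iUnion_of_finite fun i => isClosed_closedBall p _ _
    refine measure_mono_null (t := ⋃ i, frontier (p.closedBall (c i) r)) ?_
      (measure_iUnion_null fun i => (p.convex_closedBall (c i) r).addHaar_frontier volume)
    rw [hcl.frontier_eq]
    rintro x ⟨hx, hxi⟩
    obtain ⟨i, hi⟩ := Set.mem_iUnion.1 hx
    refine Set.mem_iUnion.2 ⟨i, subset_closure hi, fun h => hxi ?_⟩
    exact interior_mono (Set.subset_iUnion (fun i => p.closedBall (c i) r) i) h
  · rw [mem_interior_iff_mem_nhds]
    exact mem_of_superset (closedBall_mem_nhds p (c ⟨0, hn⟩) hr)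
      (Set.subset_iUnion (fun i => p.closedBall (c i) r) ⟨0, hn⟩)

theorem minError_mul_iUnion_closedBall {d n : ℕ} (hd : 1 ≤ d) (hn : 1 ≤ n)
    {p : Seminorm ℝ (Fin d → ℝ)} (hp : ∀ x, p x = 0 → x = 0) {r : ℝ} (hr : 0 < r)
    (c : Fin n → Fin d → ℝ)
    (hc : Pairwise fun i j => Disjoint (p.closedBall (c i) r) (p.closedBall (c j) r)) :
    minError p (⋃ i, p.closedBall (c i) r) n *
        volume (⋃ i, p.closedBall (c i) r) ^ (-(1 / (d : ℝ))) =
      volume (unitBall p) ^ (-(1 / (d : ℝ))) * (n : ℝ≥0∞) ^ (-(1 / (d : ℝ))) := by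
  classical
  have hβ := ballVol_pos hp
  have hn0 : (0 : ℝ) < n := by exact_mod_cast hn
  have hd0 : (0 : ℝ) < d := by exact_mod_cast hd
  have hdne : d ≠ 0 := by omega
  have hD := iUnion_closedBall_mem_domains hn hp hr c
  refine le_antisymm ?_ (rpow_le_minError_mul hd hp hD hn)
  have herr : minError p (⋃ i, p.closedBall (c i) r) n ≤ ENNReal.ofReal r := by
    refine minError_le_of_covers (hD.2.mono interior_subset) (F := Finset.univ.image c) ?_
      (Finset.card_image_le.trans (by simp)) fun y hy => ?_
    · intro x hx
      obtain ⟨i, -, rfl⟩ := Finset.mem_image.1 (Finset.mem_coe.1 hx)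
      exact Set.mem_iUnion.2 ⟨i, p.mem_closedBall_self hr.le⟩
    · obtain ⟨i, hi⟩ := Set.mem_iUnion.1 hy
      exact ⟨c i, Finset.mem_image_of_mem _ (Finset.mem_univ i), hi⟩
  have hvol : volume (⋃ i, p.closedBall (c i) r) = ENNReal.ofReal (n * (r ^ d * ballVol p)) := by
    rw [measure_iUnion hc fun i => (isClosed_closedBall p _ _).measurableSet]
    simp only [volume_closedBall hp _ hr, tsum_fintype, Finset.sum_const, Finset.card_univ,
      Fintype.card_fin, nsmul_eq_mul]
    rw [ENNReal.ofReal_mul (Nat.cast_nonneg n), ENNReal.ofReal_natCast]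
  refine (mul_le_mul_left herr _).trans (le_of_eq ?_)
  rw [hvol, volume_unitBall hp, ← ENNReal.ofReal_natCast, ENNReal.ofReal_rpow_of_pos hβ,
    ENNReal.ofReal_rpow_of_pos hn0, ENNReal.ofReal_rpow_of_pos (by positivity),
    ← ENNReal.ofReal_mul (by positivity), ← ENNReal.ofReal_mul (by positivity)]
  congr 1
  have h1 : (r ^ d) ^ (1 / (d : ℝ)) = r := by
    rw [one_div]
    exact Real.pow_rpow_inv_natCast hr.le hdne
  rw [Real.rpow_neg (by positivity), Real.mul_rpow hn0.le (by positivity),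
    Real.mul_rpow (by positivity) hβ.le, h1, Real.rpow_neg hβ.le, Real.rpow_neg hn0.le]
  field_simp

theorem exists_pairwise_disjoint_closedBall {d : ℕ} (hd : 1 ≤ d) {p : Seminorm ℝ (Fin d → ℝ)}
    (hp : ∀ x, p x = 0 → x = 0) (n : ℕ) :
    ∃ c : Fin n → Fin d → ℝ,
      Pairwise fun i j => Disjoint (p.closedBall (c i) 1) (p.closedBall (c j) 1) := by
  have : Nonempty (Fin d) := ⟨⟨0, hd⟩⟩
  obtain ⟨u, hu⟩ := exists_ne (0 : Fin d → ℝ)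
  have hpu : 0 < p u := lt_of_le_of_ne (apply_nonneg p u) fun h => hu (hp u h.symm)
  refine ⟨fun i => (3 * (i : ℕ) / p u : ℝ) • u, fun i j hij => Set.disjoint_left.2 fun y hi hj => ?_⟩
  rw [Seminorm.mem_closedBall] at hi hj
  have h1 := map_sub_le_add p (y - (3 * (j : ℕ) / p u : ℝ) • u) (y - (3 * (i : ℕ) / p u : ℝ) • u)
  rw [sub_sub_sub_cancel_left, ← sub_smul, map_smul_eq_mul, ← sub_div, ← mul_sub, norm_div,
    Real.norm_of_nonneg hpu.le, div_mul_cancel₀ _ hpu.ne', Real.norm_eq_abs, abs_mul,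
    abs_of_pos (by norm_num : (0 : ℝ) < 3)] at h1
  have h2 : (1 : ℝ) ≤ |((i : ℕ) : ℝ) - ((j : ℕ) : ℝ)| := by
    have : ((i : ℕ) : ℤ) - ((j : ℕ) : ℤ) ≠ 0 := by
      intro h
      exact hij (Fin.ext (by omega))
    exact_mod_cast Int.one_le_abs this
  linarith

/-! ### Rogers' upper bound for the covering constant -/

theorem measurableSet_ball_relation {d : ℕ} (p : Seminorm ℝ (Fin d → ℝ)) :
    MeasurableSet {q : (Fin d → ℝ) × (Fin d → ℝ) | p (q.2 - q.1) ≤ 1} :=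
  (isClosed_le ((continuous_seminorm p).comp (continuous_snd.sub continuous_fst))
    continuous_const).measurableSet

/-- Averaging over the centre: some translate of the unit ball removes from a subset `E` of a
cube at least the fraction of `E` given by the ratio of the volume of the ball to the volume of a
slightly larger cube. -/
theorem exists_volume_diff_closedBall_le {d : ℕ} {p : Seminorm ℝ (Fin d → ℝ)}
    (hp : ∀ x, p x = 0 → x = 0) {a : ℝ} (ha : 0 < a) (hap : ∀ x, ‖x‖ ≤ a * p x) {L : ℝ}
    (hL : 0 < L) {E : Set (Fin d → ℝ)} (hE : MeasurableSet E) (hEL : E ⊆ cube d L) :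
    ∃ x, volume.real (E \ p.closedBall x 1) ≤
      volume.real E * (1 - ballVol p / (2 * (L + a)) ^ d) := by
  have hβ := ballVol_pos hp
  have hLa : 0 ≤ L + a := by positivity
  have hEfin : volume E ≠ ∞ := ((Metric.isBounded_Icc _ _).subset hEL).measure_lt_top.ne
  have hQ : MeasurableSet (cube d (L + a)) := measurableSet_Icc
  let s : Set ((Fin d → ℝ) × (Fin d → ℝ)) := {q | p (q.2 - q.1) ≤ 1} ∩ Prod.snd ⁻¹' E
  have hs : MeasurableSet s := (measurableSet_ball_relation p).inter (measurable_snd hE)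
  have hsl : ∀ x, Prod.mk x ⁻¹' s = p.closedBall x 1 ∩ E := fun x => rfl
  have hprod : ∫⁻ x in cube d (L + a), volume (p.closedBall x 1 ∩ E) =
      volume E * ENNReal.ofReal (ballVol p) := by
    have h1 := Measure.prod_apply (μ := volume.restrict (cube d (L + a))) (ν := volume) hs
    have h2 := Measure.prod_apply_symm (μ := volume.restrict (cube d (L + a))) (ν := volume) hs
    simp only [hsl] at h1
    rw [← h1, h2]
    have h3 : ∀ y, (volume.restrict (cube d (L + a))) ((fun x => (x, y)) ⁻¹' s) =
        E.indicator (fun _ => ENNReal.ofReal (ballVol p)) y := by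
      intro y
      by_cases hy : y ∈ E
      · have h4 : (fun x => (x, y)) ⁻¹' s = p.closedBall y 1 := by
          ext x
          simp only [s, Set.mem_preimage, Set.mem_inter_iff, Set.mem_ofPred_eq, hy, and_true,
            Seminorm.mem_closedBall]
          rw [map_sub_rev]
        rw [h4, Set.indicator_of_mem hy, Measure.restrict_apply' hQ, Set.inter_eq_left.2,
          volume_closedBall hp _ one_pos]
        · simp
        · intro x hx
          refine mem_cube.2 fun i => ?_
          have h5 := mem_cube.1 (hEL hy) i
          have h6 := abs_le.1 (((norm_le_pi_norm (x - y) i).trans (hap _)).trans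
            (mul_le_of_le_one_right ha.le hx))
          rw [Pi.sub_apply] at h6
          constructor <;> linarith
      · rw [Set.indicator_of_notMem hy]
        have h4 : (fun x => (x, y)) ⁻¹' s = ∅ := by
          ext x
          simp [s, hy]
        rw [h4, measure_empty]
    simp only [h3]
    rw [lintegral_indicator hE, setLIntegral_const, mul_comm]
  have hQvol : volume (cube d (L + a)) = ENNReal.ofReal ((2 * (L + a)) ^ d) := volume_cube d hLa
  have hQpos : 0 < (2 * (L + a)) ^ d := by positivity
  obtain ⟨x, -, hx⟩ := exists_setLAverage_le (μ := volume) (s := cube d (L + a))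
    (f := fun x => volume (p.closedBall x 1 ∩ E))
    (by rw [hQvol]; simpa using hQpos) hQ.nullMeasurableSet
    (by rw [hprod]; exact ENNReal.mul_ne_top hEfin ENNReal.ofReal_ne_top)
  refine ⟨x, ?_⟩
  rw [setLAverage_eq, hprod, hQvol] at hx
  have h1 := ENNReal.toReal_mono
    (measure_ne_top_of_subset Set.inter_subset_right hEfin) hx
  rw [ENNReal.toReal_div, ENNReal.toReal_mul, ENNReal.toReal_ofReal hβ.le,
    ENNReal.toReal_ofReal hQpos.le] at h1
  have h2 := measureReal_sdiff_add_inter (μ := volume) (s := E)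
    (isClosed_closedBall p x 1).measurableSet hEfin
  rw [Set.inter_comm] at h2
  simp only [measureReal_def] at h2 ⊢
  rw [mul_sub, mul_one, ← mul_div_assoc]
  linarith

theorem exists_volume_diff_iUnion_closedBall_le {d : ℕ} {p : Seminorm ℝ (Fin d → ℝ)}
    (hp : ∀ x, p x = 0 → x = 0) {a : ℝ} (ha : 0 < a) (hap : ∀ x, ‖x‖ ≤ a * p x) {L : ℝ}
    (hL : 0 < L) (N : ℕ) :
    ∃ F : Finset (Fin d → ℝ), F.card ≤ N ∧
      volume.real (cube d L \ ⋃ x ∈ F, p.closedBall x 1) ≤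
        (2 * L) ^ d * Real.exp (-(N * (ballVol p / (2 * (L + a)) ^ d))) := by
  classical
  induction N with
  | zero =>
    refine ⟨∅, le_rfl, ?_⟩
    simp [measureReal_def, volume_cube d hL.le, ENNReal.toReal_ofReal (pow_nonneg
      (mul_nonneg zero_le_two hL.le) d)]
  | succ N ih =>
    obtain ⟨F, hFN, hF⟩ := ih
    have hmeas : MeasurableSet (⋃ x ∈ F, p.closedBall x 1) :=
      F.measurableSet_biUnion fun x _ => (isClosed_closedBall p x 1).measurableSet
    obtain ⟨x, hx⟩ := exists_volume_diff_closedBall_le hp ha hap hL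
      (measurableSet_Icc.diff hmeas) (Set.sdiff_subset (s := cube d L))
    refine ⟨insert x F, (Finset.card_insert_le _ _).trans (by omega), ?_⟩
    have hset : cube d L \ ⋃ y ∈ insert x F, p.closedBall y 1 =
        (cube d L \ ⋃ y ∈ F, p.closedBall y 1) \ p.closedBall x 1 := by
      rw [Finset.set_biUnion_insert, Set.union_comm, Set.sdiff_sdiff]
    rw [hset]
    refine hx.trans ?_
    set q := ballVol p / (2 * (L + a)) ^ d
    have h1 : 1 - q ≤ Real.exp (-q) := by linarith [Real.add_one_le_exp (-q)]
    calc _ ≤ volume.real (cube d L \ ⋃ y ∈ F, p.closedBall y 1) * Real.exp (-q) :=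
          mul_le_mul_of_nonneg_left h1 measureReal_nonneg
      _ ≤ (2 * L) ^ d * Real.exp (-(N * q)) * Real.exp (-q) := by gcongr
      _ = _ := by
        rw [mul_assoc, ← Real.exp_add]
        congr 2
        push_cast
        ring

/-- After `N` greedy steps, a maximal packing of balls of radius `η` in the part that is still
uncovered yields a covering by balls of radius `1 + η`. -/
theorem exists_covers_one_add {d : ℕ} {p : Seminorm ℝ (Fin d → ℝ)}
    (hp : ∀ x, p x = 0 → x = 0) {a : ℝ} (ha : 0 < a) (hap : ∀ x, ‖x‖ ≤ a * p x) {L : ℝ}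
    (hL : a < L) {η : ℝ} (hη : 0 < η) (hη1 : η ≤ 1) (N : ℕ) :
    ∃ F : Finset (Fin d → ℝ), Covers p F (1 + η) (cube d (L - a)) ∧
      F.card * ballVol p ≤ N * ballVol p +
        (2 * L) ^ d * Real.exp (-(N * (ballVol p / (2 * (L + a)) ^ d))) / η ^ d := by
  classical
  have hβ := ballVol_pos hp
  obtain ⟨F, hFN, hF⟩ := exists_volume_diff_iUnion_closedBall_le hp ha hap (ha.trans hL) N
  set W := cube d L \ ⋃ x ∈ F, p.closedBall x 1 with hW
  obtain ⟨G, -, hG, hGc⟩ := exists_covers_of_packing hp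
    (S := {y | y ∈ cube d (L - a) ∧ p.closedBall y η ⊆ W}) (W := W) hη
    ((Metric.isBounded_Icc _ _).subset (Set.sdiff_subset (s := cube d L))).measure_lt_top.ne
    fun x hx => hx.2
  refine ⟨F ∪ G, fun y hy => ?_, ?_⟩
  · by_cases hyS : p.closedBall y η ⊆ W
    · obtain ⟨x, hx, hyx⟩ := hG y ⟨hy, hyS⟩
      exact ⟨x, Finset.mem_union_right _ hx, by linarith⟩
    -- The ball around `y` meets one of the greedily chosen unit balls, since it stays in the cube.
    · obtain ⟨z, hz, hzW⟩ := Set.not_subset.1 hyS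
      rw [Seminorm.mem_closedBall] at hz
      have hzL : z ∈ cube d L := by
        refine mem_cube.2 fun i => ?_
        have h1 := mem_cube.1 hy i
        have h2 := abs_le.1 (((norm_le_pi_norm (z - y) i).trans (hap _)).trans
          (mul_le_of_le_one_right ha.le (hz.trans hη1)))
        rw [Pi.sub_apply] at h2
        constructor <;> linarith
      have hzU : z ∈ ⋃ x ∈ F, p.closedBall x 1 := by
        by_contra h
        exact hzW ⟨hzL, h⟩
      obtain ⟨x, hx, hzx⟩ := Set.mem_iUnion₂.1 hzU
      rw [Seminorm.mem_closedBall] at hzx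
      refine ⟨x, Finset.mem_union_left _ hx, ?_⟩
      have h1 := map_sub_le_add p (z - x) (z - y)
      rw [sub_sub_sub_cancel_left] at h1
      linarith
  · have h1 : ((F ∪ G).card : ℝ) ≤ N + G.card := by
      exact_mod_cast (Finset.card_union_le _ _).trans (Nat.add_le_add_right hFN _)
    have h2 : G.card * ballVol p ≤
        (2 * L) ^ d * Real.exp (-(N * (ballVol p / (2 * (L + a)) ^ d))) / η ^ d := by
      rw [le_div_iff₀ (by positivity)]
      linarith
    calc ((F ∪ G).card : ℝ) * ballVol p ≤ (N + G.card) * ballVol p := by gcongr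
      _ ≤ _ := by linarith

/-- Rogers' bound with a free parameter `η`: greedily placed balls of density `d * log (1 / η)` leave
the fraction `η ^ d` of a cube uncovered, so the unit balls around the centres of a packing of `η`-balls
in the rest have density at most `1`, and enlarging all the radii by the factor `1 + η` multiplies
the total density by `(1 + η) ^ d`. -/
theorem toReal_coveringConstant_le {d : ℕ} (hd : 1 ≤ d) {p : Seminorm ℝ (Fin d → ℝ)}
    (hp : ∀ x, p x = 0 → x = 0) {η : ℝ} (hη : 0 < η) (hη1 : η ≤ 1) :
    (coveringConstant p).toReal ≤ (d * -Real.log η + 1) * (1 + η) ^ d := by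
  have hβ := ballVol_pos hp
  obtain ⟨a, ha, hap⟩ := exists_norm_le_mul p hp
  set s := d * -Real.log η with hs
  have hs0 : 0 ≤ s := mul_nonneg (Nat.cast_nonneg d) (neg_nonneg.2 (Real.log_nonpos hη.le hη1))
  have hexp : Real.exp (-s) = η ^ d := by
    rw [hs, mul_neg, neg_neg, ← Real.log_pow, Real.exp_log (by positivity)]
  have key : ∀ L, a < L → (coveringConstant p).toReal * (1 - a * L⁻¹) ^ d ≤
      (s * (1 + a * L⁻¹) ^ d + ballVol p * (L⁻¹ / 2) ^ d + 1) * (1 + η) ^ d := by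
    intro L hL
    have hL0 : 0 < L := ha.trans hL
    set q := ballVol p / (2 * (L + a)) ^ d with hq
    have hq0 : 0 < q := by positivity
    obtain ⟨F, hF, hFc⟩ := exists_covers_one_add hp ha hap hL hη hη1 ⌈s / q⌉₊
    have h1 := coveringConstant_mul_le hp (sub_pos.2 hL) (by positivity) hF
    have h2 : s ≤ ⌈s / q⌉₊ * q := (div_le_iff₀ hq0).1 (Nat.le_ceil _)
    have h3 : (⌈s / q⌉₊ : ℝ) * ballVol p ≤ s * (2 * (L + a)) ^ d + ballVol p := by
      have h4 := (Nat.ceil_lt_add_one (div_nonneg hs0 hq0.le)).le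
      calc (⌈s / q⌉₊ : ℝ) * ballVol p ≤ (s / q + 1) * ballVol p := by gcongr
        _ = _ := by
          rw [hq]
          field_simp
    have h5 : (2 * L) ^ d * Real.exp (-(⌈s / q⌉₊ * q)) / η ^ d ≤ (2 * L) ^ d := by
      rw [div_le_iff₀ (by positivity), ← hexp]
      gcongr
    have h6 : (coveringConstant p).toReal * (2 * (L - a)) ^ d ≤
        (s * (2 * (L + a)) ^ d + ballVol p + (2 * L) ^ d) * (1 + η) ^ d := by
      refine h1.trans ?_
      gcongr
      linarith
    have e1 : (2 * (L - a)) ^ d = (1 - a * L⁻¹) ^ d * (2 * L) ^ d := by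
      rw [← mul_pow]
      congr 1
      field_simp
    have e2 : (2 * (L + a)) ^ d = (1 + a * L⁻¹) ^ d * (2 * L) ^ d := by
      rw [← mul_pow]
      congr 1
      field_simp
    have e3 : (L⁻¹ / 2) ^ d * (2 * L) ^ d = 1 := by
      rw [← mul_pow]
      have : L⁻¹ / 2 * (2 * L) = 1 := by field_simp
      rw [this, one_pow]
    refine le_of_mul_le_mul_right ?_ (show 0 < (2 * L) ^ d by positivity)
    calc _ = (coveringConstant p).toReal * (2 * (L - a)) ^ d := by rw [e1]; ring
      _ ≤ _ := h6
      _ = (s * ((1 + a * L⁻¹) ^ d * (2 * L) ^ d) + ballVol p * ((L⁻¹ / 2) ^ d * (2 * L) ^ d) +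
          (2 * L) ^ d) * (1 + η) ^ d := by rw [e2, e3, mul_one]
      _ = _ := by ring
  have hinv := tendsto_inv_atTop_zero (𝕜 := ℝ)
  have hl : Tendsto (fun L : ℝ => (coveringConstant p).toReal * (1 - a * L⁻¹) ^ d) atTop
      (𝓝 ((coveringConstant p).toReal * (1 - a * 0) ^ d)) :=
    ((tendsto_const_nhds.sub (hinv.const_mul a)).pow d).const_mul _
  have hr : Tendsto (fun L : ℝ =>
      (s * (1 + a * L⁻¹) ^ d + ballVol p * (L⁻¹ / 2) ^ d + 1) * (1 + η) ^ d) atTop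
      (𝓝 ((s * (1 + a * 0) ^ d + ballVol p * (0 / 2) ^ d + 1) * (1 + η) ^ d)) :=
    (((((tendsto_const_nhds.add (hinv.const_mul a)).pow d).const_mul s).add
      (((hinv.div_const 2).pow d).const_mul _)).add_const 1).mul_const _
  have h := le_of_tendsto_of_tendsto hl hr ((eventually_gt_atTop a).mono key)
  simpa [show d ≠ 0 by omega] using h

/-- The choice `η = 1 / (d * log d)` in Rogers' bound. For `d ≥ 3` the estimate
`(1 + η) ^ d ≤ exp (1 / log d) ≤ 1 + 2 / log d` suffices; it needs `log d ≥ 1`, so that `d = 2` is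
treated numerically. -/
theorem one_add_inv_pow_mul_le {d : ℕ} (hd : 2 ≤ d) :
    (d * Real.log d + d * Real.log (Real.log d) + 1) * (1 + (d * Real.log d)⁻¹) ^ d ≤
      d * Real.log d + d * Real.log (Real.log d) + 5 * d := by
  rcases hd.eq_or_lt with rfl | hd3
  · have h1 := Real.log_two_gt_d9
    have h2 := Real.log_two_lt_d9
    have h3 := Real.log_le_sub_one_of_pos (show 0 < Real.log 2 by linarith)
    have h4 : (2 * Real.log 2)⁻¹ ≤ 0.73 := by
      rw [inv_le_comm₀ (by linarith) (by norm_num)]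
      norm_num
      linarith
    have h5 : 0 < (2 * Real.log 2)⁻¹ := by positivity
    push_cast
    set A := (1 + (2 * Real.log 2)⁻¹) ^ 2 with hA
    have h6 : A ≤ 3 := by nlinarith
    have h7 : 1 ≤ A := by nlinarith
    nlinarith
  · have hd' : (3 : ℝ) ≤ d := by exact_mod_cast hd3
    set l := Real.log d with hl
    have hl1 : 1 < l := by
      rw [hl, Real.lt_log_iff_exp_lt (by linarith)]
      linarith [Real.exp_one_lt_d9]
    have hlog := Real.log_le_sub_one_of_pos (show 0 < l by linarith)
    have hlog0 : 0 ≤ Real.log l := Real.log_nonneg hl1.le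
    have hli : 0 < l⁻¹ := by positivity
    have hli1 : l⁻¹ ≤ 1 := inv_le_one_of_one_le₀ hl1.le
    have hll : l⁻¹ * l = 1 := inv_mul_cancel₀ (by linarith)
    have h1 : (1 + (d * l)⁻¹) ^ d ≤ Real.exp l⁻¹ := by
      calc (1 + (d * l)⁻¹) ^ d ≤ Real.exp (d * l)⁻¹ ^ d := by
            gcongr
            linarith [Real.add_one_le_exp (d * l)⁻¹]
        _ = Real.exp l⁻¹ := by
            rw [← Real.exp_nat_mul]
            congr 1
            field_simp
    have h2 : Real.exp l⁻¹ ≤ 1 + 2 * l⁻¹ := by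
      have h := convexOn_exp.2 (Set.mem_univ (0 : ℝ)) (Set.mem_univ 1)
        (show 0 ≤ 1 - l⁻¹ by linarith) hli.le (by ring)
      simp only [smul_eq_mul, mul_zero, zero_add, mul_one, Real.exp_zero] at h
      nlinarith [Real.exp_one_lt_d9]
    calc (d * l + d * Real.log l + 1) * (1 + (d * l)⁻¹) ^ d
        ≤ (d * l + d * Real.log l + 1) * (1 + 2 * l⁻¹) := by
          gcongr
          exact h1.trans h2
      _ = d * l + d * Real.log l + 1 + 2 * d * (l⁻¹ * l) + 2 * d * (l⁻¹ * Real.log l) + 2 * l⁻¹ := by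
          ring
      _ ≤ d * l + d * Real.log l + 1 + 2 * d * (l⁻¹ * l) + 2 * d * (l⁻¹ * (l - 1)) + 2 * l⁻¹ := by
          gcongr
      _ = d * l + d * Real.log l + 1 + 4 * d * (l⁻¹ * l) - 2 * (d - 1) * l⁻¹ := by ring
      _ ≤ _ := by
          rw [hll]
          nlinarith

theorem coveringConstant_le {d : ℕ} (hd : 2 ≤ d) {p : Seminorm ℝ (Fin d → ℝ)}
    (hp : ∀ x, p x = 0 → x = 0) :
    coveringConstant p ≤
      ENNReal.ofReal (d * Real.log d + d * Real.log (Real.log d) + 5 * d) := by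
  rw [ofReal_toReal_coveringConstant hp]
  refine ENNReal.ofReal_le_ofReal (le_trans ?_ (one_add_inv_pow_mul_le hd))
  have hd' : (2 : ℝ) ≤ d := by exact_mod_cast hd
  have hl : 0.69 ≤ Real.log d := by
    linarith [Real.log_le_log two_pos hd', Real.log_two_gt_d9]
  have h1 : 1 ≤ d * Real.log d := by nlinarith
  have h2 := toReal_coveringConstant_le (by omega) hp (η := (d * Real.log d)⁻¹)
    (by positivity) (inv_le_one_of_one_le₀ h1)
  rwa [Real.log_inv, neg_neg, Real.log_mul (by positivity) (by linarith), mul_add] at h2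

end LipApprox

theorem theorem1 (d : ℕ) (hd : 1 ≤ d) (p : Seminorm ℝ (Fin d → ℝ))
    (hp : ∀ x, p x = 0 → x = 0) :
    (∀ D ∈ LipApprox.domains d,
      Tendsto (fun n : ℕ => LipApprox.minError p D n /
          (LipApprox.coveringConstant p ^ (1 / (d : ℝ)) *
            (volume D / volume (LipApprox.unitBall p)) ^ (1 / (d : ℝ)) *
            (n : ℝ≥0∞) ^ (-(1 / (d : ℝ)))))
        atTop (𝓝 1)) ∧
    1 ≤ LipApprox.coveringConstant p ∧
    (2 ≤ d → LipApprox.coveringConstant p ≤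
      ENNReal.ofReal (d * Real.log d + d * Real.log (Real.log d) + 5 * d)) ∧
    (∀ n : ℕ, 1 ≤ n →
      IsLeast
        ((fun D => LipApprox.minError p D n * volume D ^ (-(1 / (d : ℝ)))) '' LipApprox.domains d)
        (volume (LipApprox.unitBall p) ^ (-(1 / (d : ℝ))) * (n : ℝ≥0∞) ^ (-(1 / (d : ℝ)))) ∧
      ∀ (r : ℝ) (c : Fin n → Fin d → ℝ), 0 < r →
        Pairwise (fun i j => Disjoint (p.closedBall (c i) r) (p.closedBall (c j) r)) →
        (⋃ i, p.closedBall (c i) r) ∈ LipApprox.domains d ∧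
        LipApprox.minError p (⋃ i, p.closedBall (c i) r) n *
            volume (⋃ i, p.closedBall (c i) r) ^ (-(1 / (d : ℝ))) =
          volume (LipApprox.unitBall p) ^ (-(1 / (d : ℝ))) *
            (n : ℝ≥0∞) ^ (-(1 / (d : ℝ)))) := by
  refine ⟨fun D hD => LipApprox.tendsto_minError_div hd hp hD, ?_,
    fun h => LipApprox.coveringConstant_le h hp, fun n hn => ⟨⟨?_, ?_⟩, fun r c hr hc =>
      ⟨LipApprox.iUnion_closedBall_mem_domains hn hp hr c,
        LipApprox.minError_mul_iUnion_closedBall hd hn hp hr c hc⟩⟩⟩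
  · rw [LipApprox.ofReal_toReal_coveringConstant hp]
    exact ENNReal.one_le_ofReal.2 (LipApprox.one_le_toReal_coveringConstant hp)
  · obtain ⟨c, hc⟩ := LipApprox.exists_pairwise_disjoint_closedBall hd hp n
    exact ⟨_, LipApprox.iUnion_closedBall_mem_domains hn hp one_pos c,
      LipApprox.minError_mul_iUnion_closedBall hd hn hp one_pos c hc⟩
  · rintro _ ⟨D, hD, rfl⟩
    exact LipApprox.rpow_le_minError_mul hd hp hD hn
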